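/- **Setting.** Let $\gamma>0$, $0<T\le\infty$, and let $u_0,v_0,v_1,v_2,v_3$ be Schwartz functions (only their values on $[0,\infty)$, resp. on $[0,T)$, are used). Put $\theta(\zeta)=8\gamma\zeta^4-2\zeta^2$, $\Lambda=\mathrm{diag}(1,-1)$ and $$P=\begin{pmatrix}0&u_0\\-\bar u_0&0\end{pmatrix},\qquad R=\begin{pmatrix}R_{11}&R_{12}\\R_{21}&-R_{11}\end{pmatrix},$$ $$R_{11}=-4i\gamma\zeta^2|v_0|^2-2\gamma\zeta(v_0\bar v_1-v_1\bar v_0)+i\gamma(3|v_0|^4-|v_1|^2+\bar v_0v_2+v_0\bar v_2)+i|v_0|^2,$$ $$R_{12}=-8\gamma\zeta^3v_0-4i\gamma\zeta^2v_1+2\zeta\big(\gamma v_2+(2\gamma|v_0|^2+1)v_0\big)+i\big(\gamma v_3+(6\gamma|v_0|^2+1)v_1\big),\qquad R_{21}(\zeta)=-\overline{R_{12}(\bar\zeta)} .$$ For $\mathrm{Im}\,\zeta\ge0$ let $(z(\zeta),y(\zeta))^T$ be the value at $x=0$ of the second column of the bounded continuous solution on $[0,\infty)$ of $G_3(x)=I-\int_x^\infty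 e^{-i\zeta(x-\xi)\Lambda}(PG_3)(\xi)e^{i\zeta(x-\xi)\Lambda}d\xi$. For $\mathrm{Im}\,\theta(\zeta)\le0$ let $(Z(\zeta),Y(\zeta))^T$ be the value at $t=0$ of the second column of the bounded continuous solution on $[0,T)$ of $G_2(t)=I-\int_t^Te^{i\theta(\zeta)(t-\tau)\Lambda}(RG_2)(\tau)e^{-i\theta(\zeta)(t-\tau)\Lambda}d\tau$. Put $$\rho(\zeta)=y(\zeta)\overline{Y(\bar\zeta)}+z(\zeta)\overline{Z(\bar\zeta)},\quad \delta(\zeta)=\frac{z(\zeta)}{\overline{y(\bar\zeta)}},\quad \Delta(\zeta)=-\frac{\overline{Z(\bar\zeta)}}{y(\zeta)\rho(\zeta)},\quad \omega(\zeta)=\zeta x-\theta(\zeta)t .$$ Let $\Omega_1=\{\mathrm{Im}\,\zeta>0,\ \mathrm{Im}\,\theta<0\}$, $\Omega_2=\{\mathrm{Im}\,\zeta>0,\ \mathrm{Im}\,\theta>0\}$, $\Omega_3=\{\mathrm{Im}\,\zeta<0,\ \mathrm{Im}\,\theta<0\}$, $\Omega_4=\{\mathrm{Im}\,\zeta<0,\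 \mathrm{Im}\,\theta>0\}$, $\Gamma_1=\bar\Omega_1\cap\bar\Omega_2$, $\Gamma_2=\bar\Omega_2\cap\bar\Omega_3$, $\Gamma_3=\bar\Omega_3\cap\bar\Omega_4$, $\Gamma_4=\bar\Omega_4\cap\bar\Omega_1$ and $\Gamma=\Gamma_1\cup\dots\cup\Gamma_4$. Assume that the zeros of $y$ in $\{\mathrm{Im}\,\zeta\ge0\}$ and the zeros of $\rho$ in $\bar\Omega_2$ are finite in number and simple and do not lie on $\Gamma$, and that $y$ and $\rho$ have no common zero in $\bar\Omega_2$. Let $\varsigma$ run through the zeros of $y$ in $\Omega_1$ and $\eta$ through the zeros of $\rho$ in $\Omega_2$, and let $\mathcal P$ be the set of all points $\varsigma,\bar\varsigma,\eta,\bar\eta$. **RH problem.** Fix $x\ge0$ and a real $t$ with $0\le t\le T$. A $2\times2$ matrix function $D(\zeta)=D(x,t,\zeta)$ with columns $[D]_1,[D]_2$ solves the RH problem if * $D$ is analytic in $\mathbb C\setminus(\Gamma\cup\mathcal P)$; * at every point of $\Gamma_m$ ($m=1,\dots,4$), $D$ has limits $D_+$ from $\Omega_1\cup\Omega_3$ and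 $D_-$ from $\Omega_2\cup\Omega_4$, taken from the two regions whose closures define $\Gamma_m$, and $D_-=D_+Q_m$, where $Q_2=Q_3Q_4^{-1}Q_1$ and $$Q_1=\begin{pmatrix}1&0\\ \Delta(\zeta) e^{2i\omega}&1\end{pmatrix},\quad Q_3=\begin{pmatrix}1&\overline{\Delta(\bar\zeta)}e^{-2i\omega}\\0&1\end{pmatrix},\quad Q_4=\begin{pmatrix}1&-\delta(\zeta) e^{-2i\omega}\\-\overline{\delta(\bar\zeta)}e^{2i\omega}&1+|\delta(\zeta)|^2\end{pmatrix};$$ * the singularities at the points of $\mathcal P$ are at most simple poles of the single column named below, the other column having a limit there (whose value is denoted by evaluation), with $$\mathrm{Res}_{\varsigma}[D]_1=\frac{e^{2i\omega(\varsigma)}}{z(\varsigma)\dot y(\varsigma)}[D(\varsigma)]_2,\qquad \mathrm{Res}_{\bar\varsigma}[D]_2=-\frac{e^{-2i\omega(\bar\varsigma)}}{\overline{z(\varsigma)}\,\overline{\dot y(\varsigma)}}[D(\bar\varsigma)]_1,$$ $$\mathrm{Res}_{\eta}[D]_1=-\frac{\overline{Z(\bar\eta)}\,e^{2i\omega(\eta)}}{y(\eta)\dot\rho(\eta)}[D(\eta)]_2,\qquad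 \mathrm{Res}_{\bar\eta}[D]_2=\frac{Z(\bar\eta)\,e^{-2i\omega(\bar\eta)}}{\overline{y(\eta)}\,\overline{\dot\rho(\eta)}}[D(\bar\eta)]_1 .$$ **Theorem (vanishing theorem).** The RH problem has only the zero solution among the $D$ with $D(\zeta)\to0$ as $\zeta\to\infty$ (off $\Gamma$): a function $D$ solves it with $D\to0$ if and only if $D=0$ on $\mathbb C\setminus(\Gamma\cup\mathcal P)$. In particular the RH problem with the normalization $D(\zeta)\to I$ as $\zeta\to\infty$ has at most one solution. -/

import Mathlib

open Set Filter Topology MeasureTheory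
open scoped ComplexConjugate Matrix

noncomputable section

namespace FODNLS

/-! ### Lax pair data -/

/-- The dispersion function `θ(ζ) = 8γζ⁴ - 2ζ²`. -/
def theta (γ : ℝ) (ζ : ℂ) : ℂ := 8 * γ * ζ ^ 4 - 2 * ζ ^ 2

/-- The phase `ω(x,t,ζ) = ζx - θ(ζ)t`. -/
def omega (γ x t : ℝ) (ζ : ℂ) : ℂ := ζ * x - theta γ ζ * t

/-- The matrix `P` of the `x`-part of the Lax pair at a point where `u` has the value `u`. -/
def laxP (u : ℂ) : Matrix (Fin 2) (Fin 2) ℂ := !![0, u; -conj u, 0]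

/-- The diagonal entry `R₁₁` of the `t`-part of the Lax pair, as a function of the values
`a, b, c` of `u, u_x, u_xx`. -/
def laxR11 (γ : ℝ) (ζ a b c : ℂ) : ℂ :=
  -4 * Complex.I * γ * ζ ^ 2 * (a * conj a) - 2 * γ * ζ * (a * conj b - b * conj a)
    + Complex.I * γ * (3 * (a * conj a) ^ 2 - b * conj b + conj a * c + a * conj c)
    + Complex.I * (a * conj a)

/-- The off-diagonal entry `R₁₂`, as a function of the values `a, b, c, d` of
`u, u_x, u_xx, u_xxx`. -/
def laxR12 (γ : ℝ) (ζ a b c d : ℂ) : ℂ :=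
  -8 * γ * ζ ^ 3 * a - 4 * Complex.I * γ * ζ ^ 2 * b
    + 2 * ζ * (γ * c + (2 * γ * (a * conj a) + 1) * a)
    + Complex.I * (γ * d + (6 * γ * (a * conj a) + 1) * b)

/-- The off-diagonal entry `R₂₁`, as a function of the values `a, b, c, d` of
`u, u_x, u_xx, u_xxx`. -/
def laxR21 (γ : ℝ) (ζ a b c d : ℂ) : ℂ :=
  8 * γ * ζ ^ 3 * conj a - 4 * Complex.I * γ * ζ ^ 2 * conj b
    - 2 * ζ * (γ * conj c + (2 * γ * (a * conj a) + 1) * conj a)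
    + Complex.I * (γ * conj d + (6 * γ * (a * conj a) + 1) * conj b)

/-- The matrix `R` of the `t`-part `Ψ_t = (iθ(ζ)Λ + R)Ψ` of the Lax pair; the entries of `v` are
the values of `u, u_x, u_xx, u_xxx`. -/
def laxR (γ : ℝ) (ζ : ℂ) (v : Fin 4 → ℂ) : Matrix (Fin 2) (Fin 2) ℂ :=
  !![laxR11 γ ζ (v 0) (v 1) (v 2), laxR12 γ ζ (v 0) (v 1) (v 2) (v 3);
     laxR21 γ ζ (v 0) (v 1) (v 2) (v 3), -laxR11 γ ζ (v 0) (v 1) (v 2)]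

/-! ### Spectral functions -/

/-- `g` is the second column of the eigenfunction `G₃(·, 0, ζ)`, i.e. the bounded continuous
solution on `[0, ∞)` of the second column of
`G₃(x) = I - ∫_x^∞ e^{-iζ(x-ξ)Λ} (P G₃)(ξ) e^{iζ(x-ξ)Λ} dξ`, where `P` is built from `u₀`. -/
structure IsInitialEigenfunction (u₀ : ℝ → ℂ) (ζ : ℂ) (g : ℝ → Fin 2 → ℂ) : Prop where
  continuousOn : ContinuousOn g (Ici 0)
  bounded : ∃ C : ℝ, ∀ x, 0 ≤ x → ‖g x‖ ≤ C
  fst : ∀ x : ℝ, 0 ≤ x → g x 0 =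
    -∫ ξ in Ioi x, Complex.exp (-2 * Complex.I * ζ * (x - ξ)) * (laxP (u₀ ξ) *ᵥ g ξ) 0
  snd : ∀ x : ℝ, 0 ≤ x → g x 1 = 1 - ∫ ξ in Ioi x, (laxP (u₀ ξ) *ᵥ g ξ) 1

/-- `(z(ζ), y(ζ))` is the value at `x = 0` of the second column of `G₃(·, 0, ζ)`,
for every `ζ` in the closed upper half-plane. -/
def IsInitialSpectral (u₀ : ℝ → ℂ) (y z : ℂ → ℂ) : Prop :=
  ∀ ζ : ℂ, 0 ≤ ζ.im →
    ∃ g : ℝ → Fin 2 → ℂ, IsInitialEigenfunction u₀ ζ g ∧ z ζ = g 0 0 ∧ y ζ = g 0 1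

/-- `g` is the second column of the eigenfunction `G₂(0, ·, ζ)`, i.e. the bounded continuous
solution on `[0, T)` of the second column of
`G₂(t) = I - ∫_t^T e^{iθ(ζ)(t-τ)Λ} (R G₂)(τ) e^{-iθ(ζ)(t-τ)Λ} dτ`, where `R` is built from the
boundary values `v`; `T = ∞` is allowed. -/
structure IsBoundaryEigenfunction (γ : ℝ) (T : EReal) (v : Fin 4 → ℝ → ℂ) (ζ : ℂ)
    (g : ℝ → Fin 2 → ℂ) : Prop where
  continuousOn : ContinuousOn g {t : ℝ | 0 ≤ t ∧ (t : EReal) < T}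
  bounded : ∃ C : ℝ, ∀ t : ℝ, 0 ≤ t → (t : EReal) < T → ‖g t‖ ≤ C
  fst : ∀ t : ℝ, 0 ≤ t → (t : EReal) < T → g t 0 =
    -∫ τ in {τ : ℝ | t < τ ∧ (τ : EReal) < T},
      Complex.exp (2 * Complex.I * theta γ ζ * (t - τ)) *
        (laxR γ ζ (fun j => v j τ) *ᵥ g τ) 0
  snd : ∀ t : ℝ, 0 ≤ t → (t : EReal) < T → g t 1 =
    1 - ∫ τ in {τ : ℝ | t < τ ∧ (τ : EReal) < T}, (laxR γ ζ (fun j => v j τ) *ᵥ g τ) 1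

/-- `(Z(ζ), Y(ζ))` is the value at `t = 0` of the second column of `G₂(0, ·, ζ)`,
for every `ζ` with `Im θ(ζ) ≤ 0`. -/
def IsBoundarySpectral (γ : ℝ) (T : EReal) (v : Fin 4 → ℝ → ℂ) (Y Z : ℂ → ℂ) : Prop :=
  ∀ ζ : ℂ, (theta γ ζ).im ≤ 0 →
    ∃ g : ℝ → Fin 2 → ℂ, IsBoundaryEigenfunction γ T v ζ g ∧ Z ζ = g 0 0 ∧ Y ζ = g 0 1

/-- `ρ(ζ) = y(ζ) conj(Y(conj ζ)) + z(ζ) conj(Z(conj ζ))`. -/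
def rho (y z Y Z : ℂ → ℂ) (ζ : ℂ) : ℂ :=
  y ζ * conj (Y (conj ζ)) + z ζ * conj (Z (conj ζ))

/-- `δ(ζ) = z(ζ) / conj(y(conj ζ))`. -/
def deltaS (y z : ℂ → ℂ) (ζ : ℂ) : ℂ := z ζ / conj (y (conj ζ))

/-- `Δ(ζ) = - conj(Z(conj ζ)) / (y(ζ) ρ(ζ))`. -/
def deltaL (y z Y Z : ℂ → ℂ) (ζ : ℂ) : ℂ :=
  -conj (Z (conj ζ)) / (y ζ * rho y z Y Z ζ)

/-! ### Regions and contours -/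

/-- `L₁ ∪ L₃`. -/
def regionA (γ : ℝ) : Set ℂ := {ζ | 0 < ζ.im ∧ (theta γ ζ).im < 0}

/-- `L₂ ∪ L₄`. -/
def regionB (γ : ℝ) : Set ℂ := {ζ | 0 < ζ.im ∧ 0 < (theta γ ζ).im}

/-- `L₅ ∪ L₇`. -/
def regionC (γ : ℝ) : Set ℂ := {ζ | ζ.im < 0 ∧ (theta γ ζ).im < 0}

/-- `L₆ ∪ L₈`. -/
def regionD (γ : ℝ) : Set ℂ := {ζ | ζ.im < 0 ∧ 0 < (theta γ ζ).im}

def Gamma1 (γ : ℝ) : Set ℂ := closure (regionA γ) ∩ closure (regionB γ)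

def Gamma2 (γ : ℝ) : Set ℂ := closure (regionB γ) ∩ closure (regionC γ)

def Gamma3 (γ : ℝ) : Set ℂ := closure (regionC γ) ∩ closure (regionD γ)

def Gamma4 (γ : ℝ) : Set ℂ := closure (regionD γ) ∩ closure (regionA γ)

/-- The whole jump contour. -/
def Contour (γ : ℝ) : Set ℂ := Gamma1 γ ∪ Gamma2 γ ∪ Gamma3 γ ∪ Gamma4 γ

/-! ### Jump matrices -/

section Jump

variable (γ : ℝ) (y z Y Z : ℂ → ℂ) (x t : ℝ) (ζ : ℂ)

def Q1 : Matrix (Fin 2) (Fin 2) ℂ :=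
  !![1, 0;
     deltaL y z Y Z ζ * Complex.exp (2 * Complex.I * omega γ x t ζ), 1]

def Q3 : Matrix (Fin 2) (Fin 2) ℂ :=
  !![1, conj (deltaL y z Y Z (conj ζ)) * Complex.exp (-2 * Complex.I * omega γ x t ζ);
     0, 1]

def Q4 : Matrix (Fin 2) (Fin 2) ℂ :=
  !![1, -deltaS y z ζ * Complex.exp (-2 * Complex.I * omega γ x t ζ);
     -conj (deltaS y z (conj ζ)) * Complex.exp (2 * Complex.I * omega γ x t ζ),
     1 + (‖deltaS y z ζ‖ : ℂ) ^ 2]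

def Q2 : Matrix (Fin 2) (Fin 2) ℂ :=
  Q3 γ y z Y Z x t ζ * (Q4 γ y z x t ζ)⁻¹ * Q1 γ y z Y Z x t ζ

end Jump

/-- At the contour point `ζ`, `D` has the limits `D₊` from `Ωp` and `D₋` from `Ωm`, and
`D₋ = D₊ Q`. -/
def HasJump (D : ℂ → Matrix (Fin 2) (Fin 2) ℂ) (Ωp Ωm : Set ℂ)
    (Q : Matrix (Fin 2) (Fin 2) ℂ) (ζ : ℂ) : Prop :=
  ∃ Dp Dm : Matrix (Fin 2) (Fin 2) ℂ,
    Tendsto D (𝓝[Ωp] ζ) (𝓝 Dp) ∧ Tendsto D (𝓝[Ωm] ζ) (𝓝 Dm) ∧ Dm = Dp * Q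

/-! ### Poles and residues -/

/-- The assumption on the zeros of `y` in the closed upper half-plane and of `ρ` in the closure
of `L₂ ∪ L₄`: they are finite in number, simple, off the contour, and `y` and `ρ` have no
common zero. -/
structure ZeroAssumption (γ : ℝ) (y z Y Z : ℂ → ℂ) : Prop where
  y_finite : {ζ : ℂ | 0 ≤ ζ.im ∧ y ζ = 0}.Finite
  y_mem : ∀ ζ : ℂ, 0 ≤ ζ.im → y ζ = 0 → ζ ∈ regionA γ ∪ regionB γ
  y_simple : ∀ ζ : ℂ, 0 ≤ ζ.im → y ζ = 0 → deriv y ζ ≠ 0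
  rho_finite : {ζ : ℂ | ζ ∈ closure (regionB γ) ∧ rho y z Y Z ζ = 0}.Finite
  rho_mem : ∀ ζ ∈ closure (regionB γ), rho y z Y Z ζ = 0 → ζ ∈ regionB γ
  rho_simple : ∀ ζ ∈ closure (regionB γ), rho y z Y Z ζ = 0 → deriv (rho y z Y Z) ζ ≠ 0
  disjoint : ∀ ζ ∈ closure (regionB γ), rho y z Y Z ζ = 0 → y ζ ≠ 0

/-- The zeros `ς` of `y` in `L₁ ∪ L₃`. -/
def yPoles (γ : ℝ) (y : ℂ → ℂ) : Set ℂ := {ς | ς ∈ regionA γ ∧ y ς = 0}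

/-- The zeros `η` of `ρ` in `L₂ ∪ L₄`. -/
def rhoPoles (γ : ℝ) (y z Y Z : ℂ → ℂ) : Set ℂ := {η | η ∈ regionB γ ∧ rho y z Y Z η = 0}

/-- All possible poles `ς, conj ς, η, conj η`. -/
def Poles (γ : ℝ) (y z Y Z : ℂ → ℂ) : Set ℂ :=
  {ζ | ζ ∈ yPoles γ y ∨ conj ζ ∈ yPoles γ y ∨
    ζ ∈ rhoPoles γ y z Y Z ∨ conj ζ ∈ rhoPoles γ y z Y Z}

/-- At `p` the column `k` of `D` has a limit `[D(p)]_k`, and the column `j` has at most a simple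
pole, with residue `c • [D(p)]_k` (for `D` holomorphic in a punctured neighbourhood of `p`). -/
def HasResidue (D : ℂ → Matrix (Fin 2) (Fin 2) ℂ) (p : ℂ) (j k : Fin 2) (c : ℂ) : Prop :=
  ∃ d : Fin 2 → ℂ,
    Tendsto (fun ζ => (D ζ).col k) (𝓝[≠] p) (𝓝 d) ∧
    Tendsto (fun ζ => (ζ - p) • (D ζ).col j) (𝓝[≠] p) (𝓝 (c • d))

/-- `D` satisfies the Riemann–Hilbert problem (analyticity, jumps and residues) at fixed `(x, t)`,
without a condition at infinity. -/
structure IsRHSolution (γ : ℝ) (y z Y Z : ℂ → ℂ) (x t : ℝ)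
    (D : ℂ → Matrix (Fin 2) (Fin 2) ℂ) : Prop where
  analytic : ∀ i j, DifferentiableOn ℂ (fun ζ => D ζ i j) (Contour γ ∪ Poles γ y z Y Z)ᶜ
  jump1 : ∀ ζ ∈ Gamma1 γ, HasJump D (regionA γ) (regionB γ) (Q1 γ y z Y Z x t ζ) ζ
  jump2 : ∀ ζ ∈ Gamma2 γ, HasJump D (regionC γ) (regionB γ) (Q2 γ y z Y Z x t ζ) ζ
  jump3 : ∀ ζ ∈ Gamma3 γ, HasJump D (regionC γ) (regionD γ) (Q3 γ y z Y Z x t ζ) ζ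
  jump4 : ∀ ζ ∈ Gamma4 γ, HasJump D (regionA γ) (regionD γ) (Q4 γ y z x t ζ) ζ
  res_y : ∀ ς ∈ yPoles γ y, HasResidue D ς 0 1
    (1 / (z ς * deriv y ς) * Complex.exp (2 * Complex.I * omega γ x t ς))
  res_y_conj : ∀ ς ∈ yPoles γ y, HasResidue D (conj ς) 1 0
    (-(1 / (conj (z ς) * conj (deriv y ς))) *
      Complex.exp (-2 * Complex.I * omega γ x t (conj ς)))
  res_rho : ∀ η ∈ rhoPoles γ y z Y Z, HasResidue D η 0 1
    (-(conj (Z (conj η)) / (y η * deriv (rho y z Y Z) η)) *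
      Complex.exp (2 * Complex.I * omega γ x t η))
  res_rho_conj : ∀ η ∈ rhoPoles γ y z Y Z, HasResidue D (conj η) 1 0
    (Z (conj η) / (conj (y η) * conj (deriv (rho y z Y Z) η)) *
      Complex.exp (-2 * Complex.I * omega γ x t (conj η)))

/-- `D(ζ) → N` as `ζ → ∞` off the contour. -/
def TendsToAtInfinity (γ : ℝ) (D : ℂ → Matrix (Fin 2) (Fin 2) ℂ)
    (N : Matrix (Fin 2) (Fin 2) ℂ) : Prop :=
  Tendsto D (cocompact ℂ ⊓ 𝓟 (Contour γ)ᶜ) (𝓝 N)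

end FODNLS

end

/-! The proof studies `H(ζ) = D(ζ) D(conj ζ)ᴴ` (`conjProd`) and shows that it extends to an entire
function vanishing at infinity. Across the non-real contour the jumps of the two factors cancel,
because `Q3(conj ζ)ᴴ = Q1(ζ)` (`Q3_conj`). On the real axis the two boundary values of `H` are `D₊ Q
D₊ᴴ` and its adjoint, and they agree because the jumps `Q4` and `Q2` have the form `M Mᴴ` with `M`
invertible. At the poles the residue constants at `p` and `conj p` are `c` and `-conj c`, so the
residue of `H` is zero. At the crossing points, which are the critical points of `θ` and all real,
`H` is bounded, so they are removable. Liouville's theorem gives `H = 0` (`conjProd_eq_zero`).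

Positivity now recovers `D`: on the real axis `(D₊ M)(D₊ M)ᴴ = 0` forces `D₊ = 0`, hence `D₋ = 0`.
So `D` continues across the real axis with value zero there, and vanishes near every noncritical
real point (`eventually_eq_zero`). Each of the eight components of the complement of the contour has
such a point on its boundary, so the identity theorem gives `D = 0` there, once the poles are
cleared by a polynomial (`entry_eq_zero_off_level`). Uniqueness for the normalized problem follows
by linearity. -/

namespace FODNLS

/-! ### Extension across level curves, removable singularities and Liouville's theorem. -/

/-- Painlevé's theorem for the real line: a continuous function on an open set which is holomorphic
off the real line is holomorphic. -/
theorem differentiableOn_of_continuousOn_off_real {f : ℂ → ℂ} {U : Set ℂ} (hU : IsOpen U)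
    (hc : ContinuousOn f U) (hd : ∀ ζ ∈ U, ζ.im ≠ 0 → DifferentiableAt ℂ f ζ) :
    DifferentiableOn ℂ f U := by
  refine (Complex.isConservativeOn_and_continuousOn_iff_isDifferentiableOn hU).1 ⟨?_, hc⟩
  intro z w hzw
  rw [← add_eq_zero_iff_eq_neg, Complex.wedgeIntegral_add_wedgeIntegral_eq]
  have key : ∀ z w : ℂ, Complex.Rectangle z w ⊆ U →
      (∀ s ∈ Ioo (min z.im w.im) (max z.im w.im), s ≠ 0) →
      (∫ x : ℝ in z.re..w.re, f (x + z.im * Complex.I)) -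
      (∫ x : ℝ in z.re..w.re, f (x + w.im * Complex.I)) +
      Complex.I • (∫ y : ℝ in z.im..w.im, f (w.re + y * Complex.I)) -
      Complex.I • (∫ y : ℝ in z.im..w.im, f (z.re + y * Complex.I)) = 0 := by
    intro z w hzw h0
    refine Complex.integral_boundary_rect_eq_zero_of_continuousOn_of_differentiableOn f z w
      (hc.mono hzw) fun ζ hζ => (hd ζ (hzw ?_) (h0 _ hζ.2)).differentiableWithinAt
    exact ⟨Ioo_subset_Icc_self hζ.1, Ioo_subset_Icc_self hζ.2⟩
  -- A rectangle meeting the real axis in its interior is cut along it; the two integrals over the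
  -- cut cancel, and Cauchy's theorem on each half needs only continuity up to the boundary.
  by_cases h0 : (0 : ℝ) ∈ Ioo (min z.im w.im) (max z.im w.im)
  · have h0' : (0 : ℝ) ∈ uIcc z.im w.im := Ioo_subset_Icc_self h0
    have hsub1 : uIcc z.im 0 ⊆ uIcc z.im w.im := uIcc_subset_uIcc_left h0'
    have hsub2 : uIcc 0 w.im ⊆ uIcc z.im w.im := uIcc_subset_uIcc_right h0'
    have k1 := key z (w.re : ℂ) (fun ζ hζ => hzw ⟨by simpa using hζ.1, hsub1 (by simpa using hζ.2)⟩)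
      (by
        intro s hs
        simp only [Complex.ofReal_im, mem_Ioo, inf_lt_iff, lt_sup_iff] at hs
        rintro rfl
        simp at hs
        linarith [hs.1, hs.2])
    have k2 := key (z.re : ℂ) w (fun ζ hζ => hzw ⟨by simpa using hζ.1, hsub2 (by simpa using hζ.2)⟩)
      (by
        intro s hs
        simp only [Complex.ofReal_im, mem_Ioo, inf_lt_iff, lt_sup_iff] at hs
        rintro rfl
        simp at hs
        linarith [hs.1, hs.2])
    have hint : ∀ a ∈ uIcc z.re w.re, ∀ b₁ b₂ : ℝ, uIcc b₁ b₂ ⊆ uIcc z.im w.im →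
        IntervalIntegrable (fun y : ℝ => f (a + y * Complex.I)) volume b₁ b₂ := by
      intro a ha b₁ b₂ hb
      refine ContinuousOn.intervalIntegrable (hc.comp (by fun_prop) fun s hs => hzw ⟨?_, ?_⟩)
      · simpa using ha
      · simpa using hb hs
    have e1 := intervalIntegral.integral_add_adjacent_intervals
      (hint z.re left_mem_uIcc z.im 0 hsub1) (hint z.re left_mem_uIcc 0 w.im hsub2)
    have e2 := intervalIntegral.integral_add_adjacent_intervals
      (hint w.re right_mem_uIcc z.im 0 hsub1) (hint w.re right_mem_uIcc 0 w.im hsub2)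
    rw [← e1, ← e2]
    simp only [Complex.ofReal_re, Complex.ofReal_im, smul_eq_mul, Complex.ofReal_zero, zero_mul,
      add_zero] at k1 k2 ⊢
    linear_combination k1 + k2
  · exact key z w hzw fun s hs h => h0 (h ▸ hs)

/-- Painlevé's theorem for the curve `Im g = 0` near a point where the holomorphic function `g`
has nonvanishing derivative. -/
theorem differentiableAt_of_continuousOn_off_level {f g : ℂ → ℂ} {U : Set ℂ} {q : ℂ}
    (hU : IsOpen U) (hq : q ∈ U) (hg : AnalyticAt ℂ g q) (hg' : deriv g q ≠ 0)
    (hc : ContinuousOn f U) (hd : ∀ ζ ∈ U, (g ζ).im ≠ 0 → DifferentiableAt ℂ f ζ) :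
    DifferentiableAt ℂ f q := by
  have hcd : ContDiffAt ℂ ⊤ g q := hg.contDiffAt
  have hs : HasStrictDerivAt g (deriv g q) q := hg.hasStrictDerivAt
  have hs' : HasFDerivAt g
      ((ContinuousLinearEquiv.unitsEquivAut ℂ (Units.mk0 _ hg') : ℂ ≃L[ℂ] ℂ) : ℂ →L[ℂ] ℂ) q :=
    (hs.hasStrictFDerivAt_equiv hg').hasFDerivAt
  -- The inverse function theorem makes `g` a local holomorphic coordinate, in which the curve
  -- becomes the real line.
  set φ := hcd.toOpenPartialHomeomorph g hs' (by simp) with hφ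
  have hqs : q ∈ φ.source := hcd.mem_toOpenPartialHomeomorph_source hs' (by simp)
  have hφg : ∀ ζ, φ ζ = g ζ := fun ζ => rfl
  have hψ : ContDiffAt ℂ ⊤ φ.symm (g q) := hcd.to_localInverse hs' (by simp)
  have hgt : g q ∈ φ.target := φ.map_source hqs
  have hψq : φ.symm (g q) = q := φ.left_inv hqs
  have hev : ∀ᶠ w in 𝓝 (g q), DifferentiableAt ℂ φ.symm w ∧ φ.symm w ∈ U ∧ w ∈ φ.target := by
    refine (hψ.eventually (by simp)).mono (fun w hw => hw.differentiableAt (by simp)) |>.and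
      ((hψ.continuousAt.eventually_mem (by rw [hψq]; exact hU.mem_nhds hq)).and
        (φ.open_target.mem_nhds hgt))
  obtain ⟨V, hV, hVo, hqV⟩ := _root_.eventually_nhds_iff.1 hev
  have hdiff : DifferentiableOn ℂ (f ∘ φ.symm) V := by
    refine differentiableOn_of_continuousOn_off_real hVo ?_ ?_
    · exact hc.comp (fun w hw => (hV w hw).1.continuousAt.continuousWithinAt)
        fun w hw => (hV w hw).2.1
    · intro w hw hwi
      refine DifferentiableAt.comp w (hd _ (hV w hw).2.1 ?_) (hV w hw).1
      rwa [← hφg, φ.right_inv (hV w hw).2.2]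
  have h1 : DifferentiableAt ℂ ((f ∘ φ.symm) ∘ g) q :=
    (hdiff.differentiableAt (hVo.mem_nhds hqV)).comp q hg.differentiableAt
  refine h1.congr_of_eventuallyEq ?_
  filter_upwards [φ.open_source.mem_nhds hqs] with ζ hζ
  simp only [Function.comp_apply]
  rw [← hφg, φ.left_inv hζ]

/-- Non-strict bounds pass to limits. This transfers estimates known only off the curve to the
continuous extension; the callers use `ε / 2` to recover a strict bound. -/
theorem norm_le_of_norm_le_on_dense {F : ℂ → ℂ} {V S : Set ℂ} {ε : ℝ} (hV : IsOpen V)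
    (hS : Dense S) (hF : ContinuousOn F V) (h : ∀ ζ ∈ V, ζ ∈ S → ‖F ζ‖ ≤ ε) {ζ : ℂ}
    (hζ : ζ ∈ V) : ‖F ζ‖ ≤ ε := by
  have hcl : ζ ∈ closure (V ∩ S) := hS.open_subset_closure_inter hV hζ
  have := mem_closure_iff_nhdsWithin_neBot.1 hcl
  exact le_of_tendsto ((hF ζ hζ).mono inter_subset_left).norm
    (eventually_nhdsWithin_of_forall fun w hw => h w hw.1 hw.2)

theorem extendFrom_eq_of_continuousAt {f : ℂ → ℂ} {S : Set ℂ} {ζ : ℂ} (hζ : ζ ∈ S)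
    (hf : ContinuousAt f ζ) : extendFrom S f ζ = f ζ :=
  extendFrom_eq (subset_closure hζ) hf.continuousWithinAt

/-- A holomorphic function off the curve `Im g = 0` with limits at the points of the curve extends
holomorphically across the noncritical part of the curve. -/
theorem differentiableOn_extendFrom_off_level {f g : ℂ → ℂ} {U : Set ℂ} (hU : IsOpen U)
    (hg : Differentiable ℂ g) (hS : Dense {ζ | (g ζ).im ≠ 0})
    (hg' : ∀ q ∈ U, (g q).im = 0 → deriv g q ≠ 0)
    (hd : ∀ ζ ∈ U, (g ζ).im ≠ 0 → DifferentiableAt ℂ f ζ)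
    (hlim : ∀ q ∈ U, (g q).im = 0 → ∃ L, Tendsto f (𝓝[{ζ | (g ζ).im ≠ 0}] q) (𝓝 L)) :
    DifferentiableOn ℂ (extendFrom {ζ | (g ζ).im ≠ 0} f) U := by
  set S := {ζ | (g ζ).im ≠ 0} with hSdef
  have hSo : IsOpen S := isOpen_ne_fun (Complex.continuous_im.comp hg.continuous) continuous_const
  have hc : ContinuousOn (extendFrom S f) U := by
    refine continuousOn_extendFrom (fun ζ _ => hS ζ) fun q hq => ?_
    by_cases h : (g q).im = 0
    · exact hlim q hq h
    · exact ⟨_, (hd q hq h).continuousAt.continuousWithinAt⟩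
  have hoff : ∀ ζ ∈ U, (g ζ).im ≠ 0 → DifferentiableAt ℂ (extendFrom S f) ζ := by
    intro ζ hζ hi
    refine (hd ζ hζ hi).congr_of_eventuallyEq ?_
    filter_upwards [hU.mem_nhds hζ, hSo.mem_nhds hi] with w hw hwS
    exact extendFrom_eq_of_continuousAt hwS (hd w hw hwS).continuousAt
  intro q hq
  by_cases h : (g q).im = 0
  · exact (differentiableAt_of_continuousOn_off_level hU hq (hg.analyticAt q) (hg' q hq h) hc
      hoff).differentiableWithinAt
  · exact (hoff q hq h).differentiableWithinAt

/-- Removal of finitely many singularities which are milder than simple poles. -/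
theorem exists_differentiableOn_eqOn_diff_finite {F : ℂ → ℂ} {W E : Set ℂ} (hW : IsOpen W)
    (hE : E.Finite) (hF : DifferentiableOn ℂ F (W \ E))
    (h : ∀ p ∈ W, p ∈ E → Tendsto (fun ζ => (ζ - p) * F ζ) (𝓝[≠] p) (𝓝 0)) :
    ∃ G : ℂ → ℂ, DifferentiableOn ℂ G W ∧ EqOn G F (W \ E) := by
  have hWE : IsOpen (W \ E) := hW.sdiff hE.isClosed
  -- The punctured limit is a single formula for the extension: it returns `F` wherever `F` is
  -- continuous and the removed value at the points of `E`.
  have heq : EqOn (fun ζ => limUnder (𝓝[≠] ζ) F) F (W \ E) := fun ζ hζ =>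
    (((hF.differentiableAt (hWE.mem_nhds hζ)).continuousAt).mono_left nhdsWithin_le_nhds).limUnder_eq
  refine ⟨fun ζ => limUnder (𝓝[≠] ζ) F, fun p hp => ?_, heq⟩
  by_cases hpE : p ∈ E
  · have hs : W \ (E \ {p}) ∈ 𝓝 p :=
      (hW.sdiff (hE.subset sdiff_subset).isClosed).mem_nhds ⟨hp, fun h => h.2 rfl⟩
    have hsub : (W \ (E \ {p})) \ {p} ⊆ W \ E := fun ζ hζ =>
      ⟨hζ.1.1, fun hE' => hζ.1.2 ⟨hE', hζ.2⟩⟩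
    have hlit : (fun z => F z - F p) =o[𝓝[≠] p] fun z => (z - p)⁻¹ := by
      rw [Asymptotics.isLittleO_iff_tendsto']
      · have h2 : Tendsto (fun ζ : ℂ => (ζ - p) * F p) (𝓝[≠] p) (𝓝 0) := by
          have : ContinuousAt (fun ζ : ℂ => (ζ - p) * F p) p := by fun_prop
          simpa [ContinuousAt] using this.tendsto.mono_left nhdsWithin_le_nhds
        have h3 := (h p hp hpE).sub h2
        rw [sub_zero] at h3
        refine h3.congr fun ζ => ?_
        rw [div_inv_eq_mul]; ring
      · filter_upwards [self_mem_nhdsWithin] with ζ hζ h0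
        exact absurd (inv_eq_zero.1 h0) (sub_ne_zero.2 hζ)
    have hupd := Complex.differentiableOn_update_limUnder_of_isLittleO hs (hF.mono hsub) hlit
    refine ((hupd.differentiableAt hs).congr_of_eventuallyEq ?_).differentiableWithinAt
    filter_upwards [hs] with ζ hζ
    by_cases hζp : ζ = p
    · subst hζp; simp
    · rw [Function.update_of_ne hζp]
      exact heq (hsub ⟨hζ, hζp⟩)
  · refine ((hF.differentiableAt (hWE.mem_nhds ⟨hp, hpE⟩)).congr_of_eventuallyEq
      ?_).differentiableWithinAt
    filter_upwards [hWE.mem_nhds ⟨hp, hpE⟩] with ζ hζ using heq hζ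

/-- Liouville's theorem for functions which are holomorphic off the curve `Im g = 0` and a finite
set, continuous across the curve and with removable singularities. -/
theorem eq_zero_of_tendsto_zero_off_level {f g : ℂ → ℂ} {E : Set ℂ} (hE : E.Finite)
    (hg : Differentiable ℂ g) (hS : Dense {ζ | (g ζ).im ≠ 0})
    (hg' : ∀ q ∉ E, (g q).im = 0 → deriv g q ≠ 0)
    (hd : ∀ ζ ∉ E, (g ζ).im ≠ 0 → DifferentiableAt ℂ f ζ)
    (hlim : ∀ q ∉ E, (g q).im = 0 → ∃ L, Tendsto f (𝓝[{ζ | (g ζ).im ≠ 0}] q) (𝓝 L))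
    (hsing : ∀ q ∈ E, Tendsto (fun ζ => (ζ - q) * f ζ) (𝓝[{ζ | (g ζ).im ≠ 0} \ {q}] q) (𝓝 0))
    (hinf : Tendsto f (cocompact ℂ ⊓ 𝓟 {ζ | (g ζ).im ≠ 0}) (𝓝 0)) {ζ : ℂ} (hζE : ζ ∉ E)
    (hζ : (g ζ).im ≠ 0) : f ζ = 0 := by
  set S := {ζ | (g ζ).im ≠ 0} with hSdef
  have hF : DifferentiableOn ℂ (extendFrom S f) Eᶜ :=
    differentiableOn_extendFrom_off_level hE.isClosed.isOpen_compl hg hS hg' hd hlim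
  have hFf : ∀ ζ ∉ E, ζ ∈ S → extendFrom S f ζ = f ζ := fun ζ h1 h2 =>
    extendFrom_eq_of_continuousAt h2 (hd ζ h1 h2).continuousAt
  have hres : ∀ p ∈ univ, p ∈ E →
      Tendsto (fun ζ => (ζ - p) * extendFrom S f ζ) (𝓝[≠] p) (𝓝 0) := by
    intro p _ hp
    rw [Metric.tendsto_nhds]
    intro ε hε
    have h1 : ∀ᶠ ζ in 𝓝 p, ζ ∈ S \ {p} → ‖(ζ - p) * f ζ‖ < ε / 2 := by
      have := (Metric.tendsto_nhds.1 (hsing p hp)) (ε / 2) (by positivity)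
      simpa [eventually_nhdsWithin_iff] using this
    have h2 : ∀ᶠ ζ in 𝓝 p, ζ ∉ E \ {p} :=
      (hE.subset sdiff_subset).isClosed.isOpen_compl.mem_nhds fun h => h.2 rfl
    obtain ⟨V, hV, hVo, hpV⟩ := _root_.eventually_nhds_iff.1 (h1.and h2)
    rw [eventually_nhdsWithin_iff]
    filter_upwards [hVo.mem_nhds hpV] with w hw hwp
    have hVE : V \ {p} ⊆ Eᶜ := fun u hu hE' => (hV u hu.1).2 ⟨hE', hu.2⟩
    have : ‖(w - p) * extendFrom S f w‖ ≤ ε / 2 := by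
      refine norm_le_of_norm_le_on_dense (F := fun w => (w - p) * extendFrom S f w)
        (V := V \ {p}) (hVo.sdiff isClosed_singleton) hS ?_ ?_ ⟨hw, hwp⟩
      · exact ContinuousOn.mul (by fun_prop) (hF.continuousOn.mono hVE)
      · intro u hu huS
        rw [hFf u (hVE hu) huS]
        exact ((hV u hu.1).1 ⟨huS, hu.2⟩).le
    simpa using this.trans_lt (by linarith)
  obtain ⟨G, hGd, hGF⟩ := exists_differentiableOn_eqOn_diff_finite isOpen_univ hE
    (by rwa [← compl_eq_univ_sdiff]) hres
  have hGinf : Tendsto G (cocompact ℂ) (𝓝 0) := by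
    rw [Metric.tendsto_nhds]
    intro ε hε
    have h1 := (Metric.tendsto_nhds.1 hinf) (ε / 2) (by positivity)
    rw [eventually_inf_principal] at h1
    have h2 : ∀ᶠ ζ in cocompact ℂ, ζ ∉ E := hE.isCompact.compl_mem_cocompact
    obtain ⟨K, hK, hKs⟩ := mem_cocompact.1 (h1.and h2)
    refine mem_cocompact.2 ⟨K, hK, fun w hw => ?_⟩
    have hKo : IsOpen Kᶜ := hK.isClosed.isOpen_compl
    have : ‖G w‖ ≤ ε / 2 := by
      refine norm_le_of_norm_le_on_dense hKo hS (hGd.continuousOn.mono (subset_univ _)) ?_ hw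
      intro u hu huS
      have hu' := hKs hu
      rw [hGF ⟨mem_univ _, hu'.2⟩, hFf u hu'.2 huS]
      simpa using (hu'.1 huS).le
    simpa using this.trans_lt (by linarith)
  have := Differentiable.apply_eq_of_tendsto_cocompact (differentiableOn_univ.1 hGd) ζ hGinf
  rw [← hFf ζ hζE hζ, ← hGF ⟨mem_univ _, hζE⟩, this]

/-- The curve `Im g = 0` has dense complement if the critical points of `g` on it are finite in
number. -/
theorem dense_im_ne_zero {g : ℂ → ℂ} {E : Set ℂ} (hE : E.Finite) (hg : Differentiable ℂ g)
    (hg' : ∀ q ∉ E, deriv g q ≠ 0) : Dense {ζ | (g ζ).im ≠ 0} := by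
  have hEd : Dense Eᶜ := hE.countable.dense_compl ℝ
  rw [dense_iff_inter_open]
  intro O hO hOn
  obtain ⟨q, hqO, hqE⟩ := hEd.inter_open_nonempty O hO hOn
  -- Near a noncritical point `g` is open, so the image of `O` contains non-real values.
  have hmap := (hg.analyticAt q).hasStrictDerivAt.map_nhds_eq (hg' q hqE)
  have hmem : g '' O ∈ 𝓝 (g q) := hmap ▸ image_mem_map (hO.mem_nhds hqO)
  have hd : Dense {w : ℂ | w.im ≠ 0} := by
    have : Dense (Complex.im ⁻¹' {0}ᶜ) :=
      Dense.preimage (dense_compl_singleton (0 : ℝ)) Complex.isOpenMap_im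
    exact this
  obtain ⟨_, hw, ⟨u, hu, rfl⟩⟩ := (hd.inter_nhds_nonempty hmem)
  exact ⟨u, hu, hw⟩

end FODNLS

namespace FODNLS

/-! ### The level set `Im θ = 0`, its critical points and the four regions. -/

variable {γ : ℝ}

/-- The factors show the level set as the union of the real axis, the imaginary axis and the
hyperbola `8γ(Re² - Im²) = 1`. -/
theorem theta_im (γ : ℝ) (ζ : ℂ) :
    (theta γ ζ).im = 4 * ζ.im * (ζ.re * (8 * γ * (ζ.re ^ 2 - ζ.im ^ 2) - 1)) := by
  obtain ⟨a, b⟩ := ζ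
  simp [theta, pow_succ]
  ring

theorem theta_conj (γ : ℝ) (ζ : ℂ) : theta γ (conj ζ) = conj (theta γ ζ) := by
  simp [theta, Complex.conj_ofNat]

theorem omega_conj (γ x t : ℝ) (ζ : ℂ) : omega γ x t (conj ζ) = conj (omega γ x t ζ) := by
  simp [omega, theta_conj]

theorem differentiable_theta (γ : ℝ) : Differentiable ℂ (theta γ) := by
  unfold theta; fun_prop

theorem continuous_theta_im (γ : ℝ) : Continuous fun ζ => (theta γ ζ).im :=
  Complex.continuous_im.comp (differentiable_theta γ).continuous

/-- The critical points of `θ`, i.e. the crossing points of the contour. -/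
def thetaCrit (γ : ℝ) : Set ℂ := {ζ | ζ * (8 * γ * ζ ^ 2 - 1) = 0}

theorem deriv_theta (γ : ℝ) (ζ : ℂ) : deriv (theta γ) ζ = 4 * (ζ * (8 * γ * ζ ^ 2 - 1)) := by
  have h : HasDerivAt (theta γ) (8 * γ * (4 * ζ ^ 3 * 1) - 2 * (2 * ζ ^ 1 * 1)) ζ :=
    (((hasDerivAt_id ζ).fun_pow 4).const_mul _).sub (((hasDerivAt_id ζ).fun_pow 2).const_mul _)
  rw [h.deriv]; ring

theorem deriv_theta_ne_zero {ζ : ℂ} (h : ζ ∉ thetaCrit γ) : deriv (theta γ) ζ ≠ 0 := by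
  rw [deriv_theta]; exact mul_ne_zero (by norm_num) h

theorem finite_thetaCrit (hγ : 0 < γ) : (thetaCrit γ).Finite := by
  have hγ' : (γ : ℂ) ≠ 0 := by exact_mod_cast hγ.ne'
  set c : ℂ := (8 * γ : ℂ) ^ (-(1 / 2) : ℂ) with hc
  have hc2 : 8 * γ * c ^ 2 = 1 := by
    have : c ^ 2 = (8 * γ : ℂ)⁻¹ := by
      rw [hc, ← Complex.cpow_nat_mul, ← Complex.cpow_neg_one]; norm_num
    rw [this, mul_inv_cancel₀ (by simpa using hγ')]
  refine (toFinite {0, c, -c}).subset fun ζ hζ => ?_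
  rcases mul_eq_zero.1 hζ with h | h
  · simp [h]
  · have : (8 * γ : ℂ) * ((ζ - c) * (ζ + c)) = 0 := by linear_combination h - hc2
    rcases mul_eq_zero.1 this with h | h
    · simp [hγ'] at h
    rcases mul_eq_zero.1 h with h | h
    · simp [sub_eq_zero.1 h]
    · simp [eq_neg_of_add_eq_zero_left h]

/-- Since `8γ > 0`, the equation `8γζ² = 1` has only real roots. Hence the curves cross only on the
real axis, where the positive definite jumps are available. -/
theorem im_eq_zero_of_mem_thetaCrit (hγ : 0 < γ) {ζ : ℂ} (h : ζ ∈ thetaCrit γ) : ζ.im = 0 := by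
  rcases mul_eq_zero.1 h with h | h
  · simp [h]
  · by_contra hb
    obtain ⟨a, b⟩ := ζ
    have hre := congrArg Complex.re h
    have him := congrArg Complex.im h
    simp [pow_two] at hre him hb
    have ha : a = 0 := by
      have : a * b = 0 := by rcases him with h | h <;> linarith
      simpa [hb] using this
    subst ha
    nlinarith [mul_nonneg hγ.le (mul_self_nonneg b)]

theorem dense_theta_im_ne_zero (hγ : 0 < γ) : Dense {ζ | (theta γ ζ).im ≠ 0} :=
  dense_im_ne_zero (finite_thetaCrit hγ) (differentiable_theta γ) fun _ => deriv_theta_ne_zero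

theorem theta_im_eq_zero_of_im_eq_zero {ζ : ℂ} (h : ζ.im = 0) : (theta γ ζ).im = 0 := by
  simp [theta_im, h]

/-! ### Regions -/

theorem conj_mem_regionD {ζ : ℂ} (h : ζ ∈ regionA γ) : conj ζ ∈ regionD γ := by
  simpa [regionA, regionD, theta_conj] using h

theorem conj_mem_regionA {ζ : ℂ} (h : ζ ∈ regionD γ) : conj ζ ∈ regionA γ := by
  simpa [regionA, regionD, theta_conj] using h

theorem conj_mem_regionC {ζ : ℂ} (h : ζ ∈ regionB γ) : conj ζ ∈ regionC γ := by
  simpa [regionB, regionC, theta_conj] using h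

theorem conj_mem_regionB {ζ : ℂ} (h : ζ ∈ regionC γ) : conj ζ ∈ regionB γ := by
  simpa [regionB, regionC, theta_conj] using h

theorem closure_regionA_subset : closure (regionA γ) ⊆ {ζ | 0 ≤ ζ.im ∧ (theta γ ζ).im ≤ 0} :=
  closure_minimal (fun _ h => ⟨h.1.le, h.2.le⟩)
    ((isClosed_le continuous_const Complex.continuous_im).inter
      (isClosed_le (continuous_theta_im γ) continuous_const))

theorem closure_regionB_subset : closure (regionB γ) ⊆ {ζ | 0 ≤ ζ.im ∧ 0 ≤ (theta γ ζ).im} :=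
  closure_minimal (fun _ h => ⟨h.1.le, h.2.le⟩)
    ((isClosed_le continuous_const Complex.continuous_im).inter
      (isClosed_le continuous_const (continuous_theta_im γ)))

theorem closure_regionC_subset : closure (regionC γ) ⊆ {ζ | ζ.im ≤ 0 ∧ (theta γ ζ).im ≤ 0} :=
  closure_minimal (fun _ h => ⟨h.1.le, h.2.le⟩)
    ((isClosed_le Complex.continuous_im continuous_const).inter
      (isClosed_le (continuous_theta_im γ) continuous_const))

theorem closure_regionD_subset : closure (regionD γ) ⊆ {ζ | ζ.im ≤ 0 ∧ 0 ≤ (theta γ ζ).im} :=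
  closure_minimal (fun _ h => ⟨h.1.le, h.2.le⟩)
    ((isClosed_le Complex.continuous_im continuous_const).inter
      (isClosed_le continuous_const (continuous_theta_im γ)))

theorem theta_im_eq_zero_of_mem_Contour {ζ : ℂ} (h : ζ ∈ Contour γ) : (theta γ ζ).im = 0 := by
  rcases h with ((h | h) | h) | h
  · exact le_antisymm (closure_regionA_subset h.1).2 (closure_regionB_subset h.2).2
  · exact theta_im_eq_zero_of_im_eq_zero
      (le_antisymm (closure_regionC_subset h.2).1 (closure_regionB_subset h.1).1)
  · exact le_antisymm (closure_regionC_subset h.1).2 (closure_regionD_subset h.2).2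
  · exact theta_im_eq_zero_of_im_eq_zero
      (le_antisymm (closure_regionD_subset h.1).1 (closure_regionA_subset h.2).1)

theorem isClosed_Contour (γ : ℝ) : IsClosed (Contour γ) :=
  (((isClosed_closure.inter isClosed_closure).union (isClosed_closure.inter isClosed_closure)).union
    (isClosed_closure.inter isClosed_closure)).union (isClosed_closure.inter isClosed_closure)

/-- Conjugation fixes `q` and exchanges the two regions, so adherence to one implies adherence to
the other. -/
theorem mem_Gamma4_of_mem_closure {q : ℂ} (hq : q.im = 0)
    (h : q ∈ closure (regionA γ) ∨ q ∈ closure (regionD γ)) : q ∈ Gamma4 γ := by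
  have hc : conj q = q := Complex.conj_eq_iff_im.2 hq
  rcases h with h | h
  · exact ⟨hc ▸ map_mem_closure Complex.continuous_conj h fun _ => conj_mem_regionD, h⟩
  · exact ⟨h, hc ▸ map_mem_closure Complex.continuous_conj h fun _ => conj_mem_regionA⟩

theorem mem_Gamma2_of_mem_closure {q : ℂ} (hq : q.im = 0)
    (h : q ∈ closure (regionB γ) ∨ q ∈ closure (regionC γ)) : q ∈ Gamma2 γ := by
  have hc : conj q = q := Complex.conj_eq_iff_im.2 hq
  rcases h with h | h
  · exact ⟨h, hc ▸ map_mem_closure Complex.continuous_conj h fun _ => conj_mem_regionC⟩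
  · exact ⟨hc ▸ map_mem_closure Complex.continuous_conj h fun _ => conj_mem_regionB, h⟩

/-- By the open mapping property, values in `T` near `g q` are attained near `q`. Applied to both
half-planes, this puts a noncritical point of the curve in the closure of the regions on both sides,
where the jump relation is imposed. -/
theorem mem_closure_preimage_of_deriv_ne_zero {g : ℂ → ℂ} {T U : Set ℂ} {q : ℂ}
    (hg : AnalyticAt ℂ g q) (hg' : deriv g q ≠ 0) (hU : U ∈ 𝓝 q) (hT : g q ∈ closure T) :
    q ∈ closure (U ∩ g ⁻¹' T) := by
  rw [mem_closure_iff_nhds]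
  intro O hO
  have hmap := hg.hasStrictDerivAt.map_nhds_eq hg'
  have hmem : g '' (O ∩ U) ∈ 𝓝 (g q) := hmap ▸ image_mem_map (inter_mem hO hU)
  obtain ⟨_, ⟨u, hu, rfl⟩, hw⟩ := mem_closure_iff_nhds.1 hT _ hmem
  exact ⟨u, hu.1, hu.2, hw⟩

theorem mem_Gamma1_of_theta_im_eq_zero {q : ℂ} (hq : 0 < q.im) (hθ : (theta γ q).im = 0)
    (hcrit : q ∉ thetaCrit γ) : q ∈ Gamma1 γ := by
  have hU : {ζ : ℂ | 0 < ζ.im} ∈ 𝓝 q :=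
    (isOpen_lt continuous_const Complex.continuous_im).mem_nhds hq
  constructor
  · refine mem_closure_preimage_of_deriv_ne_zero (T := {w | w.im < 0})
      ((differentiable_theta γ).analyticAt q) (deriv_theta_ne_zero hcrit) hU ?_
    rw [Complex.closure_setOfPred_im_lt]; exact hθ.le
  · refine mem_closure_preimage_of_deriv_ne_zero (T := {w | 0 < w.im})
      ((differentiable_theta γ).analyticAt q) (deriv_theta_ne_zero hcrit) hU ?_
    rw [Complex.closure_setOfPred_lt_im]; exact hθ.ge

theorem conj_mem_Gamma3 {q : ℂ} (h : q ∈ Gamma1 γ) : conj q ∈ Gamma3 γ :=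
  ⟨map_mem_closure Complex.continuous_conj h.2 fun _ => conj_mem_regionC,
    map_mem_closure Complex.continuous_conj h.1 fun _ => conj_mem_regionD⟩

theorem im_ne_zero_of_theta_im_ne_zero {ζ : ℂ} (h : (theta γ ζ).im ≠ 0) : ζ.im ≠ 0 :=
  fun h0 => h (theta_im_eq_zero_of_im_eq_zero h0)

theorem theta_im_ne_zero_subset (γ : ℝ) : {ζ | (theta γ ζ).im ≠ 0} ⊆
    (regionA γ ∪ regionD γ) ∪ (regionC γ ∪ regionB γ) := by
  intro ζ h
  rcases lt_or_gt_of_ne h with h1 | h1 <;>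
    rcases lt_or_gt_of_ne (im_ne_zero_of_theta_im_ne_zero h) with h2 | h2
  · exact Or.inr (Or.inl ⟨h2, h1⟩)
  · exact Or.inl (Or.inl ⟨h2, h1⟩)
  · exact Or.inl (Or.inr ⟨h2, h1⟩)
  · exact Or.inr (Or.inr ⟨h2, h1⟩)

theorem nhdsWithin_theta_im_le (γ : ℝ) (q : ℂ) : 𝓝[{ζ | (theta γ ζ).im ≠ 0}] q ≤
    𝓝[regionA γ ∪ regionD γ] q ⊔ 𝓝[regionC γ ∪ regionB γ] q := by
  rw [← nhdsWithin_union]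
  exact nhdsWithin_mono q (theta_im_ne_zero_subset γ)

/-- The cofactor of `4 Im ζ` in `Im θ(ζ)`. -/
def thetaCofactor (γ : ℝ) (ζ : ℂ) : ℝ := ζ.re * (8 * γ * (ζ.re ^ 2 - ζ.im ^ 2) - 1)

theorem theta_im_eq_mul_thetaCofactor (γ : ℝ) (ζ : ℂ) :
    (theta γ ζ).im = 4 * ζ.im * thetaCofactor γ ζ := theta_im γ ζ

theorem continuous_thetaCofactor (γ : ℝ) : Continuous (thetaCofactor γ) := by
  unfold thetaCofactor; fun_prop

/-- On the real axis the cofactor is `q(8γq² - 1)`, which is a quarter of `θ'`. -/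
theorem thetaCofactor_ne_zero {q : ℂ} (hq : q.im = 0) (hcrit : q ∉ thetaCrit γ) :
    thetaCofactor γ q ≠ 0 := by
  intro h0
  refine hcrit ?_
  have hqr : q = (q.re : ℂ) := by apply Complex.ext <;> simp [hq]
  have h0' : q.re * (8 * γ * q.re ^ 2 - 1) = 0 := by simpa [thetaCofactor, hq] using h0
  change q * (8 * γ * q ^ 2 - 1) = 0
  rw [hqr]; exact_mod_cast h0'

/-- Near a real point which is not a crossing point, the contour is the real line. -/
theorem nhdsWithin_theta_im_le_of_real {q : ℂ} (hq : q.im = 0) (hcrit : q ∉ thetaCrit γ) :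
    𝓝[{ζ | (theta γ ζ).im ≠ 0}] q ≤ 𝓝[regionA γ ∪ regionD γ] q ∨
    𝓝[{ζ | (theta γ ζ).im ≠ 0}] q ≤ 𝓝[regionC γ ∪ regionB γ] q := by
  -- The cofactor keeps its sign near `q`, so the sign of `Im θ` is tied to that of `Im ζ` and only
  -- one conjugate pair of regions is visible.
  have hsc := continuous_thetaCofactor γ
  have hle : ∀ {U T : Set ℂ}, U ∈ 𝓝 q → U ∩ {ζ | (theta γ ζ).im ≠ 0} ⊆ T →
      𝓝[{ζ | (theta γ ζ).im ≠ 0}] q ≤ 𝓝[T] q := fun hU hT =>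
    nhdsWithin_le_iff.2 <| mem_nhdsWithin_iff_exists_mem_nhds_inter.2 ⟨_, hU, hT⟩
  rcases lt_or_gt_of_ne (thetaCofactor_ne_zero hq hcrit) with h | h
  · refine Or.inl (hle ((isOpen_lt hsc continuous_const).mem_nhds h) ?_)
    rintro ζ ⟨h1, h2⟩
    have h1 : thetaCofactor γ ζ < 0 := h1
    have e := theta_im_eq_mul_thetaCofactor γ ζ
    rcases lt_or_gt_of_ne (im_ne_zero_of_theta_im_ne_zero h2) with h3 | h3
    · exact Or.inr ⟨h3, by rw [e]; nlinarith⟩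
    · exact Or.inl ⟨h3, by rw [e]; nlinarith⟩
  · refine Or.inr (hle ((isOpen_lt continuous_const hsc).mem_nhds h) ?_)
    rintro ζ ⟨h1, h2⟩
    have h1 : 0 < thetaCofactor γ ζ := h1
    have e := theta_im_eq_mul_thetaCofactor γ ζ
    rcases lt_or_gt_of_ne (im_ne_zero_of_theta_im_ne_zero h2) with h3 | h3
    · exact Or.inl ⟨h3, by rw [e]; nlinarith⟩
    · exact Or.inr ⟨h3, by rw [e]; nlinarith⟩

/-! ### Connectedness of the components and their real boundary points. -/

/-- One of the eight components of the complement of the contour, singled out by the signs of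
`Re ζ`, `Im ζ` and `8γ Re ζ² - 1`. -/
def sector (γ σ τ s : ℝ) : Set ℂ :=
  {ζ | 0 < σ * ζ.re ∧ 0 < τ * ζ.im ∧ 0 < s * (8 * γ * (ζ.re ^ 2 - ζ.im ^ 2) - 1)}

theorem isOpen_sector (γ σ τ s : ℝ) : IsOpen (sector γ σ τ s) :=
  IsOpen.inter (s := {ζ : ℂ | 0 < σ * ζ.re})
    (t := {ζ : ℂ | 0 < τ * ζ.im ∧ 0 < s * (8 * γ * (ζ.re ^ 2 - ζ.im ^ 2) - 1)})
    (isOpen_lt continuous_const (by fun_prop))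
    (IsOpen.inter (s := {ζ : ℂ | 0 < τ * ζ.im})
      (t := {ζ : ℂ | 0 < s * (8 * γ * (ζ.re ^ 2 - ζ.im ^ 2) - 1)})
      (isOpen_lt continuous_const (by fun_prop)) (isOpen_lt continuous_const (by fun_prop)))

/-- In the coordinates `(Re², Im²)` the conditions become linear, so the sector is a continuous
image of a convex set under signed square roots. -/
theorem isPreconnected_sector (γ : ℝ) {σ τ : ℝ} (hσ : σ ^ 2 = 1) (hτ : τ ^ 2 = 1) (s : ℝ) :
    IsPreconnected (sector γ σ τ s) := by
  have hconv : Convex ℝ {p : ℝ × ℝ | 0 < p.1 ∧ 0 < p.2 ∧ 0 < s * (8 * γ * (p.1 - p.2) - 1)} := by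
    rintro p ⟨hp1, hp2, hp3⟩ r ⟨hr1, hr2, hr3⟩ a b ha hb hab
    refine ⟨convex_Ioi (0 : ℝ) hp1 hr1 ha hb hab, convex_Ioi (0 : ℝ) hp2 hr2 ha hb hab, ?_⟩
    have h := convex_Ioi (0 : ℝ) hp3 hr3 ha hb hab
    simp only [smul_eq_mul, mem_Ioi] at h
    change 0 < s * (8 * γ * ((a • p + b • r).1 - (a • p + b • r).2) - 1)
    simp only [Prod.fst_add, Prod.snd_add, Prod.smul_fst, Prod.smul_snd, smul_eq_mul]
    have hb' : b = 1 - a := by linarith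
    subst hb'
    refine lt_of_lt_of_eq h ?_
    ring
  convert hconv.isPreconnected.image
    (fun p : ℝ × ℝ => ((σ * √p.1 : ℝ) : ℂ) + ((τ * √p.2 : ℝ) : ℂ) * Complex.I)
    (by fun_prop) using 1
  ext ζ
  constructor
  · rintro ⟨h1, h2, h3⟩
    refine ⟨(ζ.re ^ 2, ζ.im ^ 2), ⟨?_, ?_, h3⟩, ?_⟩
    · exact sq_pos_of_ne_zero (right_ne_zero_of_mul h1.ne')
    · exact sq_pos_of_ne_zero (right_ne_zero_of_mul h2.ne')
    · have e1 : √(ζ.re ^ 2) = σ * ζ.re := by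
        rw [← Real.sqrt_sq h1.le, mul_pow, hσ, one_mul]
      have e2 : √(ζ.im ^ 2) = τ * ζ.im := by
        rw [← Real.sqrt_sq h2.le, mul_pow, hτ, one_mul]
      simp only [e1, e2]
      rw [← mul_assoc, ← mul_assoc, ← sq, ← sq, hσ, hτ, one_mul, one_mul, Complex.re_add_im]
  · rintro ⟨p, ⟨h1, h2, h3⟩, rfl⟩
    have e1 := Real.sq_sqrt h1.le
    have e2 := Real.sq_sqrt h2.le
    have f1 := Real.sqrt_pos.2 h1
    have f2 := Real.sqrt_pos.2 h2
    simp only [sector, mem_ofPred_eq, Complex.add_re, Complex.ofReal_re, Complex.mul_re,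
      Complex.I_re, mul_zero, Complex.ofReal_im, Complex.I_im, mul_one, sub_self, add_zero,
      Complex.add_im, Complex.mul_im, zero_add, mul_pow, hσ, hτ, one_mul, e1, e2]
    refine ⟨?_, ?_, h3⟩
    · rw [← mul_assoc, ← sq, hσ, one_mul]; exact f1
    · rw [← mul_assoc, ← sq, hτ, one_mul]; exact f2

theorem exists_real_mem_closure_sector (hγ : 0 < γ) {σ τ s : ℝ} (hσ : σ ^ 2 = 1) (hτ : τ ^ 2 = 1)
    (hs : s = 1 ∨ s = -1) :
    ∃ q ∈ closure (sector γ σ τ s), q.im = 0 ∧ q ∉ thetaCrit γ := by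
  -- The two witnesses give `8γr² - 1 = 7` and `8γr² - 1 = -1/2`.
  obtain ⟨r, hr0, hr⟩ : ∃ r : ℝ, 0 < r ∧ 0 < s * (8 * γ * r ^ 2 - 1) := by
    have hg := Real.sqrt_pos.2 hγ
    have hg2 := Real.sq_sqrt hγ.le
    rcases hs with rfl | rfl
    · refine ⟨1 / √γ, by positivity, ?_⟩
      rw [div_pow, hg2]; field_simp; norm_num
    · refine ⟨1 / (4 * √γ), by positivity, ?_⟩
      rw [div_pow, mul_pow, hg2]; field_simp; norm_num
  have hσ0 : σ ≠ 0 := by rintro rfl; simp at hσ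
  refine ⟨((σ * r : ℝ) : ℂ), ?_, Complex.ofReal_im _, ?_⟩
  · have hev : ∀ᶠ ε : ℝ in 𝓝[>] 0,
        ((σ * r : ℝ) : ℂ) + ((τ * ε : ℝ) : ℂ) * Complex.I ∈ sector γ σ τ s := by
      have hc : Continuous fun ε : ℝ => s * (8 * γ * (r ^ 2 - ε ^ 2) - 1) := by fun_prop
      have h0 : ∀ᶠ ε : ℝ in 𝓝 0, 0 < s * (8 * γ * (r ^ 2 - ε ^ 2) - 1) :=
        (isOpen_lt continuous_const hc).mem_nhds (by simpa using hr)
      filter_upwards [nhdsWithin_le_nhds h0, self_mem_nhdsWithin] with ε h1 h2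
      have h2 : 0 < ε := h2
      simp only [sector, mem_ofPred_eq, Complex.add_re, Complex.ofReal_re, Complex.mul_re,
        Complex.I_re, mul_zero, Complex.ofReal_im, Complex.I_im, mul_one, sub_self, add_zero,
        Complex.add_im, Complex.mul_im, zero_add, mul_pow, hσ, hτ, one_mul]
      refine ⟨?_, ?_, h1⟩
      · rw [← mul_assoc, ← sq, hσ, one_mul]; exact hr0
      · rw [← mul_assoc, ← sq, hτ, one_mul]; exact h2
    refine mem_closure_of_tendsto (b := 𝓝[>] (0 : ℝ)) ?_ hev
    have hc : Continuous fun ε : ℝ => ((σ * r : ℝ) : ℂ) + ((τ * ε : ℝ) : ℂ) * Complex.I := by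
      fun_prop
    simpa using (hc.tendsto 0).mono_left nhdsWithin_le_nhds
  · intro h
    have h : ((σ * r : ℝ) : ℂ) * (8 * γ * ((σ * r : ℝ) : ℂ) ^ 2 - 1) = 0 := h
    have h' : (σ * r) * (8 * γ * (σ * r) ^ 2 - 1) = 0 := by exact_mod_cast h
    rcases mul_eq_zero.1 h' with h' | h'
    · exact mul_ne_zero hσ0 hr0.ne' h'
    · rw [mul_pow, hσ, one_mul] at h'
      simp [h'] at hr

/-- Every point off the contour lies in a connected region whose boundary contains a real point
which is not a crossing point. -/
theorem exists_preconnected_region (hγ : 0 < γ) {ζ : ℂ} (hζ : (theta γ ζ).im ≠ 0) :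
    ∃ W : Set ℂ, IsOpen W ∧ IsPreconnected W ∧ ζ ∈ W ∧ (∀ w ∈ W, (theta γ w).im ≠ 0) ∧
      ∃ q ∈ closure W, q.im = 0 ∧ q ∉ thetaCrit γ := by
  have hsign : ∀ a : ℝ, a ≠ 0 → ∃ σ : ℝ, (σ = 1 ∨ σ = -1) ∧ 0 < σ * a := by
    intro a ha
    rcases lt_or_gt_of_ne ha with h | h
    · exact ⟨-1, Or.inr rfl, by linarith⟩
    · exact ⟨1, Or.inl rfl, by linarith⟩
  rw [theta_im] at hζ
  obtain ⟨h1, h2⟩ := mul_ne_zero_iff.1 hζ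
  obtain ⟨h2, h3⟩ := mul_ne_zero_iff.1 h2
  obtain ⟨σ, hσ, hσ'⟩ := hsign _ h2
  obtain ⟨τ, hτ, hτ'⟩ := hsign _ (right_ne_zero_of_mul h1)
  obtain ⟨s, hs, hs'⟩ := hsign _ h3
  have hσ2 : σ ^ 2 = 1 := by rcases hσ with rfl | rfl <;> norm_num
  have hτ2 : τ ^ 2 = 1 := by rcases hτ with rfl | rfl <;> norm_num
  refine ⟨sector γ σ τ s, isOpen_sector γ σ τ s, isPreconnected_sector γ hσ2 hτ2 s,
    ⟨hσ', hτ', hs'⟩, ?_, exists_real_mem_closure_sector hγ hσ2 hτ2 hs⟩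
  rintro w ⟨w1, w2, w3⟩
  rw [theta_im]
  exact mul_ne_zero (mul_ne_zero (by norm_num) (right_ne_zero_of_mul w2.ne'))
    (mul_ne_zero (right_ne_zero_of_mul w1.ne') (right_ne_zero_of_mul w3.ne'))

end FODNLS

namespace FODNLS

/-! ### Jump matrices on the real line -/

theorem conj_exp_omega (γ x t : ℝ) (ζ : ℂ) :
    conj (Complex.exp (2 * Complex.I * omega γ x t ζ)) =
      Complex.exp (-2 * Complex.I * omega γ x t (conj ζ)) := by
  rw [← Complex.exp_conj]
  congr 1
  simp [omega_conj, Complex.conj_ofNat]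

/-- On the real axis conjugation turns `e^{2iω}` into its inverse, so `Q4` is Hermitian, and it has
an explicit unit lower triangular Cholesky factor. -/
theorem Q4_eq_mul_conjTranspose (γ : ℝ) (y z : ℂ → ℂ) (x t : ℝ) {q : ℂ} (hq : q.im = 0) :
    ∃ M : Matrix (Fin 2) (Fin 2) ℂ, IsUnit M.det ∧ Q4 γ y z x t q = M * Mᴴ := by
  have hc : conj q = q := Complex.conj_eq_iff_im.2 hq
  have he : conj (Complex.exp (2 * Complex.I * omega γ x t q)) =
      Complex.exp (-2 * Complex.I * omega γ x t q) := by
    rw [conj_exp_omega, hc]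
  have he' : Complex.exp (2 * Complex.I * omega γ x t q) *
      Complex.exp (-2 * Complex.I * omega γ x t q) = 1 := by
    rw [← Complex.exp_add, ← Complex.exp_zero]
    congr 1; ring
  refine ⟨!![1, 0; -conj (deltaS y z q) * Complex.exp (2 * Complex.I * omega γ x t q), 1],
    by simp [Matrix.det_fin_two], ?_⟩
  rw [Q4, hc]
  have h4 := Complex.mul_conj' (deltaS y z q)
  ext i j
  fin_cases i <;> fin_cases j <;>
    simp only [Matrix.mul_apply, Fin.sum_univ_two, Matrix.conjTranspose_apply, Matrix.of_apply,
      Matrix.cons_val', Matrix.cons_val_zero, Matrix.cons_val_one, Matrix.cons_val_fin_one,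
      Fin.zero_eta, Fin.mk_one, RCLike.star_def, map_mul, map_neg, map_one, map_zero, he,
      Complex.conj_conj]
  · ring
  · ring
  · ring
  · rw [← h4]
    linear_combination (-(deltaS y z q * conj (deltaS y z q))) * he'

/-- This Schwarz symmetry cancels the jump of `conjProd` across the non-real contour. -/
theorem Q3_conj (γ : ℝ) (y z Y Z : ℂ → ℂ) (x t : ℝ) (ζ : ℂ) :
    (Q3 γ y z Y Z x t (conj ζ))ᴴ = Q1 γ y z Y Z x t ζ := by
  have he : conj (Complex.exp (-2 * Complex.I * omega γ x t (conj ζ))) =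
      Complex.exp (2 * Complex.I * omega γ x t ζ) := by
    rw [← Complex.exp_conj]
    congr 1
    simp [omega_conj, Complex.conj_ofNat]
  ext i j
  fin_cases i <;> fin_cases j <;>
    simp only [Q3, Q1, Matrix.conjTranspose_apply, Matrix.of_apply,
      Matrix.cons_val', Matrix.cons_val_zero, Matrix.cons_val_one, Matrix.cons_val_fin_one,
      Fin.zero_eta, Fin.mk_one, RCLike.star_def, map_mul, map_one, map_zero, he,
      Complex.conj_conj]

/-- On the real axis `Q1 = Q3ᴴ`, so `Q2` is a congruence of the positive definite `Q4⁻¹` and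
inherits its factorization. -/
theorem Q2_eq_mul_conjTranspose (γ : ℝ) (y z Y Z : ℂ → ℂ) (x t : ℝ) {q : ℂ} (hq : q.im = 0) :
    ∃ M : Matrix (Fin 2) (Fin 2) ℂ, IsUnit M.det ∧ Q2 γ y z Y Z x t q = M * Mᴴ := by
  have hc : conj q = q := Complex.conj_eq_iff_im.2 hq
  obtain ⟨M, hM, hQ4⟩ := Q4_eq_mul_conjTranspose γ y z x t hq
  have h13 := Q3_conj γ y z Y Z x t q
  rw [hc] at h13
  refine ⟨Q3 γ y z Y Z x t q * Mᴴ⁻¹, ?_, ?_⟩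
  · rw [Matrix.det_mul]
    refine IsUnit.mul (by simp [Q3, Matrix.det_fin_two]) ?_
    rw [Matrix.isUnit_nonsing_inv_det_iff, Matrix.det_conjTranspose]
    exact hM.star
  · rw [Q2, hQ4, ← h13, Matrix.conjTranspose_mul, Matrix.mul_inv_rev,
      Matrix.conjTranspose_nonsing_inv, Matrix.conjTranspose_conjTranspose]
    simp only [Matrix.mul_assoc]

/-! ### The product `D(ζ) D(conj ζ)ᴴ` -/

/-- The product `D(ζ) D(conj ζ)ᴴ`. -/
def conjProd (D : ℂ → Matrix (Fin 2) (Fin 2) ℂ) (ζ : ℂ) : Matrix (Fin 2) (Fin 2) ℂ :=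
  D ζ * (D (conj ζ))ᴴ

variable {D D' : ℂ → Matrix (Fin 2) (Fin 2) ℂ}

theorem conjProd_conj (D : ℂ → Matrix (Fin 2) (Fin 2) ℂ) (ζ : ℂ) :
    conjProd D (conj ζ) = (conjProd D ζ)ᴴ := by
  simp [conjProd, Matrix.conjTranspose_mul]

theorem tendsto_conj_nhdsWithin {S T : Set ℂ} (h : ∀ ζ ∈ S, conj ζ ∈ T) (q : ℂ) :
    Tendsto (fun ζ : ℂ => conj ζ) (𝓝[S] q) (𝓝[T] (conj q)) :=
  Complex.continuous_conj.continuousWithinAt.tendsto_nhdsWithin h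

theorem tendsto_conjProd {S T : Set ℂ} {q : ℂ} {M N : Matrix (Fin 2) (Fin 2) ℂ}
    (hST : ∀ ζ ∈ S, conj ζ ∈ T) (h1 : Tendsto D (𝓝[S] q) (𝓝 M))
    (h2 : Tendsto D (𝓝[T] (conj q)) (𝓝 N)) : Tendsto (conjProd D) (𝓝[S] q) (𝓝 (M * Nᴴ)) :=
  h1.mul ((Continuous.matrix_conjTranspose continuous_id).tendsto N |>.comp
    (h2.comp (tendsto_conj_nhdsWithin hST q)))

open scoped ComplexOrder in
/-- At a real point of the contour with positive definite jump, the product `D(ζ) D(conj ζ)ᴴ`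
is continuous, and if it vanishes then so do the boundary values of `D`. -/
theorem tendsto_conjProd_of_real {Ωp Ωm : Set ℂ} {Q : Matrix (Fin 2) (Fin 2) ℂ} {q : ℂ}
    (hq : q.im = 0) (h1 : ∀ ζ ∈ Ωp, conj ζ ∈ Ωm) (h2 : ∀ ζ ∈ Ωm, conj ζ ∈ Ωp)
    (hQ : ∃ M : Matrix (Fin 2) (Fin 2) ℂ, IsUnit M.det ∧ Q = M * Mᴴ)
    (h : q ∈ closure Ωp ∨ q ∈ closure Ωm → HasJump D Ωp Ωm Q q) :
    (∃ L, Tendsto (conjProd D) (𝓝[Ωp ∪ Ωm] q) (𝓝 L)) ∧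
      (Tendsto (conjProd D) (𝓝[Ωp ∪ Ωm] q) (𝓝 0) → Tendsto D (𝓝[Ωp ∪ Ωm] q) (𝓝 0)) := by
  have hc : conj q = q := Complex.conj_eq_iff_im.2 hq
  -- If `q` adheres to neither region, the filter is trivial and every limit statement is vacuous.
  by_cases hcl : q ∈ closure Ωp ∪ closure Ωm
  · obtain ⟨Dp, Dm, hDp, hDm, rfl⟩ := h hcl
    obtain ⟨M, hM, rfl⟩ := hQ
    have e1 : Tendsto (conjProd D) (𝓝[Ωp] q) (𝓝 (Dp * (M * Mᴴ) * Dpᴴ)) := by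
      have := tendsto_conjProd h1 hDp (by rwa [hc])
      simpa [Matrix.conjTranspose_mul, Matrix.mul_assoc] using this
    have e2 : Tendsto (conjProd D) (𝓝[Ωm] q) (𝓝 (Dp * (M * Mᴴ) * Dpᴴ)) :=
      tendsto_conjProd h2 hDm (by rwa [hc])
    have e : Tendsto (conjProd D) (𝓝[Ωp ∪ Ωm] q) (𝓝 (Dp * (M * Mᴴ) * Dpᴴ)) := by
      rw [nhdsWithin_union]; exact e1.sup e2
    refine ⟨⟨_, e⟩, fun h0 => ?_⟩
    rw [← closure_union, mem_closure_iff_nhdsWithin_neBot] at hcl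
    have hz : (Dp * M) * (Dp * M)ᴴ = 0 := by
      rw [Matrix.conjTranspose_mul, ← tendsto_nhds_unique e h0]
      simp only [Matrix.mul_assoc]
    have hDM : Dp * M = 0 := Matrix.self_mul_conjTranspose_eq_zero.1 hz
    have hD0 : Dp = 0 := by
      have := congrArg (· * M⁻¹) hDM
      simpa [Matrix.mul_assoc, Matrix.mul_nonsing_inv M hM] using this
    subst hD0
    rw [zero_mul] at hDm
    rw [nhdsWithin_union]
    exact hDp.sup hDm
  · rw [← closure_union, mem_closure_iff_nhdsWithin_neBot, not_neBot] at hcl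
    simp [hcl]

/-- In each column product only one factor is singular at `p`, so the pole is at most simple. The
two contributions to the residue are `c d conj d'` and `-c d conj d'`. -/
theorem HasResidue.tendsto_mul_conjProd {p : ℂ} {j k : Fin 2} {c : ℂ} (hjk : j ≠ k)
    (h : HasResidue D p j k c) (h' : HasResidue D (conj p) k j (-conj c)) (a b : Fin 2) :
    Tendsto (fun ζ => (ζ - p) * conjProd D ζ a b) (𝓝[≠] p) (𝓝 0) := by
  obtain ⟨d, hk, hj⟩ := h
  obtain ⟨d', hj', hk'⟩ := h'
  have hcj : Tendsto (fun ζ : ℂ => conj ζ) (𝓝[≠] p) (𝓝[≠] (conj p)) :=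
    tendsto_conj_nhdsWithin (S := {p}ᶜ) (T := {conj p}ᶜ) (fun ζ hζ h => hζ (star_injective h)) p
  have hk := (continuous_apply a).continuousAt.tendsto.comp hk
  have hj := (continuous_apply a).continuousAt.tendsto.comp hj
  have hj' := (Complex.continuous_conj.tendsto _).comp
    (((continuous_apply b).continuousAt.tendsto.comp hj').comp hcj)
  have hk' := (Complex.continuous_conj.tendsto _).comp
    (((continuous_apply b).continuousAt.tendsto.comp hk').comp hcj)
  have hsum : ∀ f : Fin 2 → ℂ, f 0 + f 1 = f j + f k := by
    intro f
    fin_cases j <;> fin_cases k <;> simp_all [add_comm]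
  have := (hj.mul hj').add (hk.mul hk')
  have e0 : (c • d) a * conj (d' b) + d a * conj ((-conj c • d') b) = 0 := by
    simp only [Pi.smul_apply, smul_eq_mul, map_mul, map_neg, Complex.conj_conj]; ring
  rw [e0] at this
  refine this.congr fun ζ => ?_
  simp only [conjProd, Matrix.mul_apply, Fin.sum_univ_two, Matrix.conjTranspose_apply,
    RCLike.star_def]
  rw [hsum fun i => D ζ a i * conj (D (conj ζ) b i)]
  simp only [Function.comp_apply, Pi.smul_apply, Matrix.col_apply, smul_eq_mul, map_mul, map_sub,
    Complex.conj_conj]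
  ring

/-- Both columns are covered, so every entry of `D` becomes removable after multiplication by a
polynomial vanishing at the poles. -/
theorem HasResidue.exists_tendsto_mul {p : ℂ} {j k : Fin 2} {c : ℂ} (hjk : j ≠ k)
    (h : HasResidue D p j k c) (a b : Fin 2) :
    ∃ L, Tendsto (fun ζ => (ζ - p) * D ζ a b) (𝓝[≠] p) (𝓝 L) := by
  obtain ⟨d, hk, hj⟩ := h
  have hb : b = j ∨ b = k := by
    fin_cases j <;> fin_cases k <;> fin_cases b <;> simp_all
  rcases hb with rfl | rfl
  · exact ⟨_, (continuous_apply a).continuousAt.tendsto.comp hj⟩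
  · have h1 : Tendsto (fun ζ : ℂ => ζ - p) (𝓝[≠] p) (𝓝 (p - p)) :=
      (Continuous.tendsto (by fun_prop) p).mono_left nhdsWithin_le_nhds
    exact ⟨_, h1.mul ((continuous_apply a).continuousAt.tendsto.comp hk)⟩

theorem HasResidue.sub {p : ℂ} {j k : Fin 2} {c : ℂ} (h : HasResidue D p j k c)
    (h' : HasResidue D' p j k c) : HasResidue (D - D') p j k c := by
  obtain ⟨d, hk, hj⟩ := h
  obtain ⟨d', hk', hj'⟩ := h'
  refine ⟨d - d', hk.sub hk', ?_⟩
  rw [smul_sub]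
  refine (hj.sub hj').congr fun ζ => ?_
  rw [← smul_sub]; rfl

theorem HasJump.sub {Ωp Ωm : Set ℂ} {Q : Matrix (Fin 2) (Fin 2) ℂ} {q : ℂ}
    (h : HasJump D Ωp Ωm Q q) (h' : HasJump D' Ωp Ωm Q q) : HasJump (D - D') Ωp Ωm Q q := by
  obtain ⟨Dp, Dm, h1, h2, rfl⟩ := h
  obtain ⟨Dp', Dm', h1', h2', rfl⟩ := h'
  exact ⟨Dp - Dp', _, h1.sub h1', h2.sub h2', (sub_mul _ _ _).symm⟩

variable {γ x t : ℝ} {y z Y Z : ℂ → ℂ}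

/-! ### Poles -/

theorem conj_mem_Poles {ζ : ℂ} : conj ζ ∈ Poles γ y z Y Z ↔ ζ ∈ Poles γ y z Y Z := by
  simp only [Poles, mem_ofPred_eq, Complex.conj_conj]
  tauto

theorem ZeroAssumption.finite_Poles (h : ZeroAssumption γ y z Y Z) : (Poles γ y z Y Z).Finite := by
  have h1 : (yPoles γ y).Finite := h.y_finite.subset fun ζ hζ => ⟨hζ.1.1.le, hζ.2⟩
  have h2 : (rhoPoles γ y z Y Z).Finite :=
    h.rho_finite.subset fun ζ hζ => ⟨subset_closure hζ.1, hζ.2⟩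
  have hinj : Function.Injective (fun ζ : ℂ => conj ζ) := star_injective
  exact h1.union ((h1.preimage hinj.injOn).union (h2.union (h2.preimage hinj.injOn)))

theorem theta_im_ne_zero_of_mem_Poles {ζ : ℂ} (h : ζ ∈ Poles γ y z Y Z) :
    (theta γ ζ).im ≠ 0 := by
  have hc : (theta γ (conj ζ)).im ≠ 0 → (theta γ ζ).im ≠ 0 := by
    rw [theta_conj, Complex.conj_im, neg_ne_zero]; exact id
  rcases h with h | h | h | h
  · exact h.1.2.ne
  · exact hc h.1.2.ne
  · exact h.1.2.ne'
  · exact hc h.1.2.ne'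

/-- The residue conditions at `p` and `conj p` are related by Schwarz symmetry. -/
theorem IsRHSolution.exists_hasResidue (h : IsRHSolution γ y z Y Z x t D) {p : ℂ}
    (hp : p ∈ Poles γ y z Y Z) :
    ∃ (j k : Fin 2) (c : ℂ), j ≠ k ∧ HasResidue D p j k c ∧
      HasResidue D (conj p) k j (-conj c) := by
  have hy : ∀ ς ∈ yPoles γ y, ∃ c : ℂ, HasResidue D ς 0 1 c ∧
      HasResidue D (conj ς) 1 0 (-conj c) := by
    intro ς hς
    refine ⟨_, h.res_y ς hς, ?_⟩
    convert h.res_y_conj ς hς using 1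
    rw [map_mul, conj_exp_omega]
    simp
  have hr : ∀ η ∈ rhoPoles γ y z Y Z, ∃ c : ℂ, HasResidue D η 0 1 c ∧
      HasResidue D (conj η) 1 0 (-conj c) := by
    intro η hη
    refine ⟨_, h.res_rho η hη, ?_⟩
    convert h.res_rho_conj η hη using 1
    rw [map_mul, conj_exp_omega]
    simp
  -- At a conjugate pole the columns exchange roles and the constant is `-conj c`; applying `c ↦
  -- -conj c` twice returns `c`.
  have key : (∃ c : ℂ, HasResidue D (conj p) 0 1 c ∧
      HasResidue D (conj (conj p)) 1 0 (-conj c)) → ∃ (j k : Fin 2) (c : ℂ), j ≠ k ∧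
        HasResidue D p j k c ∧ HasResidue D (conj p) k j (-conj c) := by
    rintro ⟨c, h1, h2⟩
    rw [Complex.conj_conj] at h2
    exact ⟨1, 0, -conj c, by simp, h2, by simpa using h1⟩
  rcases hp with hp | hp | hp | hp
  · obtain ⟨c, hc⟩ := hy p hp
    exact ⟨0, 1, c, by simp, hc⟩
  · exact key (hy _ hp)
  · obtain ⟨c, hc⟩ := hr p hp
    exact ⟨0, 1, c, by simp, hc⟩
  · exact key (hr _ hp)

theorem IsRHSolution.sub (h : IsRHSolution γ y z Y Z x t D) (h' : IsRHSolution γ y z Y Z x t D') :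
    IsRHSolution γ y z Y Z x t (D - D') where
  analytic i j := (h.analytic i j).sub (h'.analytic i j)
  jump1 ζ hζ := (h.jump1 ζ hζ).sub (h'.jump1 ζ hζ)
  jump2 ζ hζ := (h.jump2 ζ hζ).sub (h'.jump2 ζ hζ)
  jump3 ζ hζ := (h.jump3 ζ hζ).sub (h'.jump3 ζ hζ)
  jump4 ζ hζ := (h.jump4 ζ hζ).sub (h'.jump4 ζ hζ)
  res_y ζ hζ := (h.res_y ζ hζ).sub (h'.res_y ζ hζ)
  res_y_conj ζ hζ := (h.res_y_conj ζ hζ).sub (h'.res_y_conj ζ hζ)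
  res_rho ζ hζ := (h.res_rho ζ hζ).sub (h'.res_rho ζ hζ)
  res_rho_conj ζ hζ := (h.res_rho_conj ζ hζ).sub (h'.res_rho_conj ζ hζ)

end FODNLS

namespace FODNLS

variable {D : ℂ → Matrix (Fin 2) (Fin 2) ℂ} {γ x t : ℝ} {y z Y Z : ℂ → ℂ}

/-! ### Holomorphy and vanishing of the product. -/

theorem regionA_union_regionD_subset (γ : ℝ) :
    regionA γ ∪ regionD γ ⊆ {ζ | (theta γ ζ).im ≠ 0} := by
  rintro ζ (h | h)
  exacts [h.2.ne, h.2.ne']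

theorem regionC_union_regionB_subset (γ : ℝ) :
    regionC γ ∪ regionB γ ⊆ {ζ | (theta γ ζ).im ≠ 0} := by
  rintro ζ (h | h)
  exacts [h.2.ne, h.2.ne']

theorem ZeroAssumption.isOpen_compl (h : ZeroAssumption γ y z Y Z) :
    IsOpen (Contour γ ∪ Poles γ y z Y Z)ᶜ :=
  ((isClosed_Contour γ).union h.finite_Poles.isClosed).isOpen_compl

theorem IsRHSolution.differentiableAt (h : IsRHSolution γ y z Y Z x t D)
    (hz : ZeroAssumption γ y z Y Z) {ζ : ℂ} (hζ : (theta γ ζ).im ≠ 0)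
    (hP : ζ ∉ Poles γ y z Y Z) (i j : Fin 2) : DifferentiableAt ℂ (fun w => D w i j) ζ := by
  refine (h.analytic i j).differentiableAt (hz.isOpen_compl.mem_nhds ?_)
  rintro (h1 | h1)
  exacts [hζ (theta_im_eq_zero_of_mem_Contour h1), hP h1]

theorem IsRHSolution.differentiableAt_conjProd (h : IsRHSolution γ y z Y Z x t D)
    (hz : ZeroAssumption γ y z Y Z) {ζ : ℂ} (hζ : (theta γ ζ).im ≠ 0)
    (hP : ζ ∉ Poles γ y z Y Z) (i j : Fin 2) :
    DifferentiableAt ℂ (fun w => conjProd D w i j) ζ := by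
  have hconj : ∀ k, DifferentiableAt ℂ (fun w => conj (D (conj w) j k)) ζ := fun k =>
    differentiableAt_conj_conj_iff.2 <| h.differentiableAt hz
      (by rw [theta_conj, Complex.conj_im]; exact neg_ne_zero.2 hζ)
      (fun h => hP (conj_mem_Poles.1 h)) j k
  simp only [conjProd, Matrix.mul_apply, Fin.sum_univ_two, Matrix.conjTranspose_apply,
    RCLike.star_def]
  exact ((h.differentiableAt hz hζ hP i 0).mul (hconj 0)).add
    ((h.differentiableAt hz hζ hP i 1).mul (hconj 1))

theorem IsRHSolution.tendsto_real_AD (h : IsRHSolution γ y z Y Z x t D) {q : ℂ} (hq : q.im = 0) :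
    (∃ L, Tendsto (conjProd D) (𝓝[regionA γ ∪ regionD γ] q) (𝓝 L)) ∧
      (Tendsto (conjProd D) (𝓝[regionA γ ∪ regionD γ] q) (𝓝 0) →
        Tendsto D (𝓝[regionA γ ∪ regionD γ] q) (𝓝 0)) :=
  tendsto_conjProd_of_real hq (fun _ => conj_mem_regionD) (fun _ => conj_mem_regionA)
    (Q4_eq_mul_conjTranspose γ y z x t hq)
    fun hcl => h.jump4 q (mem_Gamma4_of_mem_closure hq hcl)

theorem IsRHSolution.tendsto_real_CB (h : IsRHSolution γ y z Y Z x t D) {q : ℂ} (hq : q.im = 0) :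
    (∃ L, Tendsto (conjProd D) (𝓝[regionC γ ∪ regionB γ] q) (𝓝 L)) ∧
      (Tendsto (conjProd D) (𝓝[regionC γ ∪ regionB γ] q) (𝓝 0) →
        Tendsto D (𝓝[regionC γ ∪ regionB γ] q) (𝓝 0)) :=
  tendsto_conjProd_of_real hq (fun _ => conj_mem_regionB) (fun _ => conj_mem_regionC)
    (Q2_eq_mul_conjTranspose γ y z Y Z x t hq)
    fun hcl => h.jump2 q (mem_Gamma2_of_mem_closure hq hcl.symm)

/-- The product `D(ζ) D(conj ζ)ᴴ` has no jump on the part of the contour in the upper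
half-plane. -/
theorem IsRHSolution.tendsto_conjProd_of_mem_Gamma1 (h : IsRHSolution γ y z Y Z x t D) {q : ℂ}
    (hq : 0 < q.im) (hq1 : q ∈ Gamma1 γ) :
    ∃ L, Tendsto (conjProd D) (𝓝[{ζ | (theta γ ζ).im ≠ 0}] q) (𝓝 L) := by
  obtain ⟨Dp, _, h1, h2, rfl⟩ := h.jump1 q hq1
  obtain ⟨Dp', _, h3, h4, rfl⟩ := h.jump3 _ (conj_mem_Gamma3 hq1)
  have e1 := tendsto_conjProd (fun _ => conj_mem_regionD) h1 h4
  have e2 := tendsto_conjProd (fun _ => conj_mem_regionC) h2 h3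
  rw [Matrix.conjTranspose_mul, Q3_conj, ← Matrix.mul_assoc] at e1
  have e := e1.sup e2
  rw [← nhdsWithin_union] at e
  refine ⟨_, e.mono_left (nhdsWithin_le_iff.2 ?_)⟩
  have hU : {ζ : ℂ | 0 < ζ.im} ∈ 𝓝 q :=
    (isOpen_lt continuous_const Complex.continuous_im).mem_nhds hq
  filter_upwards [self_mem_nhdsWithin, nhdsWithin_le_nhds hU] with ζ h5 h6
  rcases lt_or_gt_of_ne h5 with h5 | h5
  exacts [Or.inl ⟨h6, h5⟩, Or.inr ⟨h6, h5⟩]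

theorem IsRHSolution.exists_tendsto_conjProd (h : IsRHSolution γ y z Y Z x t D) {q : ℂ}
    (hq : (theta γ q).im = 0) (hcrit : q ∉ thetaCrit γ) :
    ∃ L, Tendsto (conjProd D) (𝓝[{ζ | (theta γ ζ).im ≠ 0}] q) (𝓝 L) := by
  have hcc : ∀ ζ, (theta γ ζ).im ≠ 0 → (theta γ (conj ζ)).im ≠ 0 := fun ζ hζ => by
    rw [theta_conj, Complex.conj_im]; exact neg_ne_zero.2 hζ
  rcases lt_trichotomy q.im 0 with him | him | him
  · have hcrit' : conj q ∉ thetaCrit γ := by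
      intro h'
      have := congrArg conj (show conj q * (8 * γ * conj q ^ 2 - 1) = 0 from h')
      exact hcrit (show q * (8 * γ * q ^ 2 - 1) = 0 by simpa [Complex.conj_ofNat] using this)
    have him' : 0 < (conj q).im := by simpa using him
    obtain ⟨L, hL⟩ := h.tendsto_conjProd_of_mem_Gamma1 him' <|
      mem_Gamma1_of_theta_im_eq_zero him' (by rw [theta_conj, Complex.conj_im, hq, neg_zero]) hcrit'
    refine ⟨Lᴴ, (((Continuous.matrix_conjTranspose continuous_id).tendsto L).comp
      (hL.comp (tendsto_conj_nhdsWithin hcc q))).congr fun ζ => ?_⟩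
    simp [conjProd_conj]
  · rcases nhdsWithin_theta_im_le_of_real him hcrit with hle | hle
    · obtain ⟨L, hL⟩ := (h.tendsto_real_AD him).1
      exact ⟨L, hL.mono_left hle⟩
    · obtain ⟨L, hL⟩ := (h.tendsto_real_CB him).1
      exact ⟨L, hL.mono_left hle⟩
  · exact h.tendsto_conjProd_of_mem_Gamma1 him (mem_Gamma1_of_theta_im_eq_zero him hq hcrit)

theorem TendsToAtInfinity.tendsto_conjProd (h : TendsToAtInfinity γ D 0) :
    Tendsto (conjProd D) (cocompact ℂ ⊓ 𝓟 {ζ | (theta γ ζ).im ≠ 0}) (𝓝 0) := by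
  have h1 : Tendsto D (cocompact ℂ ⊓ 𝓟 {ζ | (theta γ ζ).im ≠ 0}) (𝓝 0) :=
    Tendsto.mono_left h <| inf_le_inf_left _ <| principal_mono.2 fun ζ hζ hC =>
      hζ (theta_im_eq_zero_of_mem_Contour hC)
  have hc : Tendsto (fun ζ : ℂ => conj ζ) (cocompact ℂ ⊓ 𝓟 {ζ | (theta γ ζ).im ≠ 0})
      (cocompact ℂ ⊓ 𝓟 {ζ | (theta γ ζ).im ≠ 0}) := by
    refine tendsto_inf.2 ⟨?_, ?_⟩
    · exact (Complex.conjLIE.toHomeomorph.isClosedEmbedding.tendsto_cocompact).mono_left inf_le_left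
    · refine tendsto_inf_right (tendsto_principal_principal.2 fun ζ hζ => ?_)
      have hζ : (theta γ ζ).im ≠ 0 := hζ
      change (theta γ (conj ζ)).im ≠ 0
      rw [theta_conj, Complex.conj_im]; exact neg_ne_zero.2 hζ
  have := h1.mul (((Continuous.matrix_conjTranspose continuous_id).tendsto 0).comp (h1.comp hc))
  rwa [zero_mul] at this

theorem tendsto_sub_mul_zero_of_tendsto {f : ℂ → ℂ} {S : Set ℂ} {q L : ℂ}
    (h : Tendsto f (𝓝[S] q) (𝓝 L)) : Tendsto (fun ζ => (ζ - q) * f ζ) (𝓝[S] q) (𝓝 0) := by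
  have h1 : Tendsto (fun ζ : ℂ => ζ - q) (𝓝[S] q) (𝓝 0) := by
    have : Continuous fun ζ : ℂ => ζ - q := by fun_prop
    simpa using (this.tendsto q).mono_left nhdsWithin_le_nhds
  simpa using h1.mul h

theorem tendsto_entry {F : ℂ → Matrix (Fin 2) (Fin 2) ℂ} {l : Filter ℂ}
    {M : Matrix (Fin 2) (Fin 2) ℂ} (h : Tendsto F l (𝓝 M)) (i j : Fin 2) :
    Tendsto (fun ζ => F ζ i j) l (𝓝 (M i j)) :=
  ((continuous_id.matrix_elem i j).tendsto M).comp h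

/-- The product `D(ζ) D(conj ζ)ᴴ` vanishes for a solution which tends to zero at infinity. -/
theorem IsRHSolution.conjProd_eq_zero (hγ : 0 < γ) (h : IsRHSolution γ y z Y Z x t D)
    (hz : ZeroAssumption γ y z Y Z) (hinf : TendsToAtInfinity γ D 0) {ζ : ℂ}
    (hζ : (theta γ ζ).im ≠ 0) (hP : ζ ∉ Poles γ y z Y Z) : conjProd D ζ = 0 := by
  ext i j
  refine eq_zero_of_tendsto_zero_off_level (f := fun ζ => conjProd D ζ i j)
    ((finite_thetaCrit hγ).union hz.finite_Poles)
    (differentiable_theta γ) (dense_theta_im_ne_zero hγ) ?_ ?_ ?_ ?_ ?_ ?_ hζ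
  · exact fun q hq _ => deriv_theta_ne_zero fun h' => hq (Or.inl h')
  · exact fun w hw hwi => h.differentiableAt_conjProd hz hwi (fun h' => hw (Or.inr h')) i j
  · intro q hq hqi
    obtain ⟨L, hL⟩ := h.exists_tendsto_conjProd hqi fun h' => hq (Or.inl h')
    exact ⟨_, tendsto_entry hL i j⟩
  · rintro q (hq | hq)
    · have him := im_eq_zero_of_mem_thetaCrit hγ hq
      obtain ⟨L₁, h1⟩ := (h.tendsto_real_AD him).1
      obtain ⟨L₂, h2⟩ := (h.tendsto_real_CB him).1
      exact ((tendsto_sub_mul_zero_of_tendsto (tendsto_entry h1 i j)).sup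
        (tendsto_sub_mul_zero_of_tendsto (tendsto_entry h2 i j))).mono_left
        ((nhdsWithin_mono q sdiff_subset).trans (nhdsWithin_theta_im_le γ q))
    · obtain ⟨a, b, c, hab, h1, h2⟩ := h.exists_hasResidue hq
      exact (h1.tendsto_mul_conjProd hab h2 i j).mono_left
        (nhdsWithin_mono q fun w hw => hw.2)
  · exact tendsto_entry hinf.tendsto_conjProd i j
  · rintro (h' | h')
    exacts [hζ (theta_im_eq_zero_of_im_eq_zero (im_eq_zero_of_mem_thetaCrit hγ h')), hP h']

/-! ### From the vanishing product to the vanishing solution. -/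

/-- A solution which tends to zero at infinity vanishes near every real point which is not a
crossing point. -/
theorem IsRHSolution.eventually_eq_zero (hγ : 0 < γ) (h : IsRHSolution γ y z Y Z x t D)
    (hz : ZeroAssumption γ y z Y Z) (hinf : TendsToAtInfinity γ D 0) {q : ℂ}
    (hq : q.im = 0) (hcrit : q ∉ thetaCrit γ) (i j : Fin 2) :
    ∀ᶠ ζ in 𝓝[{ζ | (theta γ ζ).im ≠ 0}] q, D ζ i j = 0 := by
  set S := {ζ | (theta γ ζ).im ≠ 0} with hS
  have hdense : Dense S := dense_theta_im_ne_zero hγ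
  -- Inside `U` the level set reduces to the real axis, with no crossing points and no poles.
  set U := {ζ | thetaCofactor γ ζ ≠ 0} \ (thetaCrit γ ∪ Poles γ y z Y Z) with hU
  have hUo : IsOpen U := (isOpen_ne_fun (continuous_thetaCofactor γ) continuous_const).sdiff
    ((finite_thetaCrit hγ).union hz.finite_Poles).isClosed
  have hqU : q ∈ U := ⟨thetaCofactor_ne_zero hq hcrit, fun h' => h'.elim hcrit fun h' =>
    theta_im_ne_zero_of_mem_Poles h' (theta_im_eq_zero_of_im_eq_zero hq)⟩
  have hlim : ∀ p ∈ U, p.im = 0 → Tendsto (fun ζ => D ζ i j) (𝓝[S] p) (𝓝 0) := by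
    intro p hp him
    have hcp : p ∉ thetaCrit γ := fun h' => hp.2 (Or.inl h')
    have h0 : ∀ T ⊆ S, Tendsto (conjProd D) (𝓝[T] p) (𝓝 0) := by
      intro T hT
      refine tendsto_const_nhds.congr' ?_
      filter_upwards [self_mem_nhdsWithin, nhdsWithin_le_nhds (hUo.mem_nhds hp)] with w hw hwU
      exact (h.conjProd_eq_zero hγ hz hinf (hT hw) fun h' => hwU.2 (Or.inr h')).symm
    rcases nhdsWithin_theta_im_le_of_real him hcp with hle | hle
    · exact tendsto_entry (((h.tendsto_real_AD him).2
        (h0 _ (regionA_union_regionD_subset γ))).mono_left hle) i j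
    · exact tendsto_entry (((h.tendsto_real_CB him).2
        (h0 _ (regionC_union_regionB_subset γ))).mono_left hle) i j
  have hdiff : ∀ ζ ∈ U, (theta γ ζ).im ≠ 0 → DifferentiableAt ℂ (fun w => D w i j) ζ :=
    fun ζ hζ hi => h.differentiableAt hz hi (fun h' => hζ.2 (Or.inr h')) i j
  have hext := differentiableOn_extendFrom_off_level hUo (differentiable_theta γ) hdense
    (fun p hp _ => deriv_theta_ne_zero fun h' => hp.2 (Or.inl h')) hdiff (by
      intro p hp him
      rw [theta_im_eq_mul_thetaCofactor] at him
      refine ⟨0, hlim p hp ?_⟩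
      simpa [show thetaCofactor γ p ≠ 0 from hp.1] using him)
  have han : AnalyticAt ℂ (extendFrom S fun ζ => D ζ i j) q := hext.analyticAt (hUo.mem_nhds hqU)
  -- The extension is zero on the real axis near `q`; these zeros accumulate at `q`, so the identity
  -- theorem applies.
  have hfreq : ∃ᶠ ζ in 𝓝[≠] q, extendFrom S (fun ζ => D ζ i j) ζ = 0 := by
    have ht : Tendsto (fun ε : ℝ => q + ε) (𝓝[≠] 0) (𝓝[≠] q) := by
      have hc : Continuous fun ε : ℝ => q + (ε : ℂ) := by fun_prop
      refine tendsto_nhdsWithin_iff.2 ⟨?_, ?_⟩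
      · simpa using (hc.tendsto 0).mono_left nhdsWithin_le_nhds
      · filter_upwards [self_mem_nhdsWithin] with ε hε
        simpa using hε
    refine ht.frequently (Eventually.frequently ?_)
    filter_upwards [(tendsto_nhdsWithin_iff.1 ht).1.eventually (hUo.mem_nhds hqU)] with ε hε
    exact extendFrom_eq (hdense _) (hlim _ hε (by simp [hq]))
  have hev := (han.frequently_zero_iff_eventually_zero).1 hfreq
  filter_upwards [self_mem_nhdsWithin, nhdsWithin_le_nhds hev,
    nhdsWithin_le_nhds (hUo.mem_nhds hqU)] with ζ h1 h2 h3
  rw [← h2]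
  exact (extendFrom_eq_of_continuousAt h1 (hdiff ζ h3 h1).continuousAt).symm

/-- Vanishing spreads from a real boundary point through the component. Multiplying by `m = ∏ (w -
p)` makes the entry holomorphic on all of `W`, so connectedness of `W` with the poles removed is not
needed. -/
theorem IsRHSolution.entry_eq_zero_off_level (hγ : 0 < γ) (h : IsRHSolution γ y z Y Z x t D)
    (hz : ZeroAssumption γ y z Y Z) (hinf : TendsToAtInfinity γ D 0) {ζ : ℂ}
    (hζ : (theta γ ζ).im ≠ 0) (hP : ζ ∉ Poles γ y z Y Z) (i j : Fin 2) : D ζ i j = 0 := by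
  obtain ⟨W, hWo, hWc, hζW, hWθ, q, hqW, hq, hcrit⟩ := exists_preconnected_region hγ hζ
  have hfin := hz.finite_Poles
  set P := Poles γ y z Y Z
  set m : ℂ → ℂ := fun w => ∏ p ∈ hfin.toFinset, (w - p) with hm
  have hmd : Differentiable ℂ m := by fun_prop
  obtain ⟨G, hGd, hG⟩ := exists_differentiableOn_eqOn_diff_finite
    (F := fun w => m w * D w i j) hWo hfin
    (fun w hw => (hmd.differentiableAt.mul
      (h.differentiableAt hz (hWθ w hw.1) hw.2 i j)).differentiableWithinAt) (by
    intro p _ hp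
    obtain ⟨a, b, c, hab, h1, -⟩ := h.exists_hasResidue hp
    obtain ⟨L, hL⟩ := h1.exists_tendsto_mul hab i j
    have hmp : m p = 0 := Finset.prod_eq_zero (hfin.mem_toFinset.2 hp) (sub_self p)
    have := ((hmd.continuous.tendsto p).mono_left nhdsWithin_le_nhds).mul hL
    rw [hmp, zero_mul] at this
    exact this.congr fun w => by ring)
  obtain ⟨O, hO, hOo, hqO⟩ := _root_.eventually_nhds_iff.1
    (eventually_nhdsWithin_iff.1 (h.eventually_eq_zero hγ hz hinf hq hcrit i j))
  have hne : (O ∩ W).Nonempty := mem_closure_iff.1 hqW O hOo hqO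
  have hOW : IsOpen (O ∩ W) := hOo.inter hWo
  obtain ⟨w, hw, hwP⟩ := (hfin.countable.dense_compl ℝ).inter_open_nonempty _ hOW hne
  have hev : G =ᶠ[𝓝 w] 0 := by
    filter_upwards [hOW.mem_nhds hw, hfin.isClosed.isOpen_compl.mem_nhds hwP] with u hu huP
    rw [hG ⟨hu.2, huP⟩]
    simp [hO u hu.1 (hWθ u hu.2)]
  have hzero := (hGd.analyticOnNhd hWo).eqOn_zero_of_preconnected_of_eventuallyEq_zero hWc hw.2 hev
    hζW
  rw [hG ⟨hζW, hP⟩] at hzero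
  refine (mul_eq_zero.1 hzero).resolve_left (Finset.prod_ne_zero_iff.2 fun p hp h0 => hP ?_)
  rw [sub_eq_zero.1 h0]
  exact hfin.mem_toFinset.1 hp

/-- The vanishing theorem: a solution which tends to zero at infinity vanishes. -/
theorem IsRHSolution.eq_zero (hγ : 0 < γ) (h : IsRHSolution γ y z Y Z x t D)
    (hz : ZeroAssumption γ y z Y Z) (hinf : TendsToAtInfinity γ D 0) {ζ : ℂ}
    (hζ : ζ ∉ Contour γ ∪ Poles γ y z Y Z) : D ζ = 0 := by
  ext i j
  -- Continuity of `D` off the contour and density of `Im θ ≠ 0` avoid identifying the contour with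
  -- the full level set.
  refine norm_le_zero_iff.1 (norm_le_of_norm_le_on_dense (F := fun w => D w i j) hz.isOpen_compl
    (dense_theta_im_ne_zero hγ) (h.analytic i j).continuousOn ?_ hζ)
  intro w hw hwθ
  rw [h.entry_eq_zero_off_level hγ hz hinf hwθ (fun h' => hw (Or.inr h')) i j, norm_zero]

/-! ### The zero solution -/

theorem hasJump_of_eq_zero {Ωp Ωm : Set ℂ} {Q : Matrix (Fin 2) (Fin 2) ℂ} {q : ℂ}
    (hp : ∀ᶠ ζ in 𝓝[Ωp] q, D ζ = 0) (hm : ∀ᶠ ζ in 𝓝[Ωm] q, D ζ = 0) : HasJump D Ωp Ωm Q q :=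
  ⟨0, 0, tendsto_const_nhds.congr' (hp.mono fun _ h => h.symm),
    tendsto_const_nhds.congr' (hm.mono fun _ h => h.symm), (zero_mul Q).symm⟩

theorem hasResidue_of_eq_zero {p c : ℂ} {j k : Fin 2} (h : ∀ᶠ ζ in 𝓝[≠] p, D ζ = 0) :
    HasResidue D p j k c := by
  refine ⟨0, tendsto_const_nhds.congr' (h.mono fun ζ h => ?_), ?_⟩
  · simp only [h]; rfl
  · rw [smul_zero]
    refine tendsto_const_nhds.congr' (h.mono fun ζ h => ?_)
    simp only [h]; exact (smul_zero (ζ - p)).symm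

/-- The poles are finite in number and off the closed contour, so `D` is zero on the approach to
each contour point from the regions and on a punctured neighbourhood of each pole; its values on the
exceptional set play no role. -/
theorem isRHSolution_of_eq_zero (hz : ZeroAssumption γ y z Y Z)
    (h : ∀ ζ, ζ ∉ Contour γ ∪ Poles γ y z Y Z → D ζ = 0) : IsRHSolution γ y z Y Z x t D := by
  have hjump : ∀ q ∈ Contour γ, ∀ Ω ⊆ {ζ | (theta γ ζ).im ≠ 0}, ∀ᶠ ζ in 𝓝[Ω] q, D ζ = 0 := by
    intro q hq Ω hΩ
    have hqP : q ∉ Poles γ y z Y Z := fun h' =>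
      theta_im_ne_zero_of_mem_Poles h' (theta_im_eq_zero_of_mem_Contour hq)
    filter_upwards [self_mem_nhdsWithin,
      nhdsWithin_le_nhds (hz.finite_Poles.isClosed.isOpen_compl.mem_nhds hqP)] with ζ h1 h2
    refine h ζ ?_
    rintro (h' | h')
    exacts [hΩ h1 (theta_im_eq_zero_of_mem_Contour h'), h2 h']
  have hres : ∀ p ∈ Poles γ y z Y Z, ∀ᶠ ζ in 𝓝[≠] p, D ζ = 0 := by
    intro p hp
    have hpC : p ∉ Contour γ := fun h' =>
      theta_im_ne_zero_of_mem_Poles hp (theta_im_eq_zero_of_mem_Contour h')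
    have h2 : (Poles γ y z Y Z \ {p})ᶜ ∈ 𝓝 p :=
      (hz.finite_Poles.subset sdiff_subset).isClosed.isOpen_compl.mem_nhds fun h' => h'.2 rfl
    filter_upwards [self_mem_nhdsWithin, nhdsWithin_le_nhds h2,
      nhdsWithin_le_nhds ((isClosed_Contour γ).isOpen_compl.mem_nhds hpC)] with ζ h1 h2 h3
    refine h ζ ?_
    rintro (h' | h')
    exacts [h3 h', h2 ⟨h', h1⟩]
  have hA : regionA γ ⊆ {ζ | (theta γ ζ).im ≠ 0} := fun _ h => h.2.ne
  have hB : regionB γ ⊆ {ζ | (theta γ ζ).im ≠ 0} := fun _ h => h.2.ne'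
  have hC : regionC γ ⊆ {ζ | (theta γ ζ).im ≠ 0} := fun _ h => h.2.ne
  have hD : regionD γ ⊆ {ζ | (theta γ ζ).im ≠ 0} := fun _ h => h.2.ne'
  exact
  { analytic := fun i j => (differentiableOn_const 0).congr fun ζ hζ => by
      rw [h ζ hζ]; rfl
    jump1 := fun q hq =>
      have hq' : q ∈ Contour γ := Or.inl (Or.inl (Or.inl hq))
      hasJump_of_eq_zero (hjump q hq' _ hA) (hjump q hq' _ hB)
    jump2 := fun q hq =>
      have hq' : q ∈ Contour γ := Or.inl (Or.inl (Or.inr hq))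
      hasJump_of_eq_zero (hjump q hq' _ hC) (hjump q hq' _ hB)
    jump3 := fun q hq =>
      have hq' : q ∈ Contour γ := Or.inl (Or.inr hq)
      hasJump_of_eq_zero (hjump q hq' _ hC) (hjump q hq' _ hD)
    jump4 := fun q hq =>
      have hq' : q ∈ Contour γ := Or.inr hq
      hasJump_of_eq_zero (hjump q hq' _ hA) (hjump q hq' _ hD)
    res_y := fun ς hς => hasResidue_of_eq_zero (hres ς (Or.inl hς))
    res_y_conj := fun ς hς => hasResidue_of_eq_zero
      (hres _ (Or.inr (Or.inl (by rwa [Complex.conj_conj]))))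
    res_rho := fun η hη => hasResidue_of_eq_zero (hres η (Or.inr (Or.inr (Or.inl hη))))
    res_rho_conj := fun η hη => hasResidue_of_eq_zero
      (hres _ (Or.inr (Or.inr (Or.inr (by rwa [Complex.conj_conj]))))) }

theorem tendsToAtInfinity_of_eq_zero (hz : ZeroAssumption γ y z Y Z)
    (h : ∀ ζ, ζ ∉ Contour γ ∪ Poles γ y z Y Z → D ζ = 0) : TendsToAtInfinity γ D 0 := by
  refine tendsto_const_nhds.congr' ?_
  rw [EventuallyEq, eventually_inf_principal]
  filter_upwards [hz.finite_Poles.isCompact.compl_mem_cocompact] with ζ h1 h2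
  exact (h ζ fun h' => h'.elim h2 h1).symm

end FODNLS

theorem theorem4p2 (γ : ℝ) (hγ : 0 < γ) (T : EReal) (hT : 0 < T)
    (u₀ : SchwartzMap ℝ ℂ) (v : Fin 4 → SchwartzMap ℝ ℂ)
    (y z Y Z : ℂ → ℂ)
    (hyz : FODNLS.IsInitialSpectral (fun x => u₀ x) y z)
    (hYZ : FODNLS.IsBoundarySpectral γ T (fun j t => v j t) Y Z)
    (hzeros : FODNLS.ZeroAssumption γ y z Y Z)
    (x t : ℝ) (hx : 0 ≤ x) (ht : 0 ≤ t) (htT : (t : EReal) ≤ T) :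
    (∀ D : ℂ → Matrix (Fin 2) (Fin 2) ℂ,
      (FODNLS.IsRHSolution γ y z Y Z x t D ∧ FODNLS.TendsToAtInfinity γ D 0) ↔
        ∀ ζ, ζ ∉ FODNLS.Contour γ ∪ FODNLS.Poles γ y z Y Z → D ζ = 0) ∧
    (∀ D D' : ℂ → Matrix (Fin 2) (Fin 2) ℂ,
      FODNLS.IsRHSolution γ y z Y Z x t D → FODNLS.TendsToAtInfinity γ D 1 →
      FODNLS.IsRHSolution γ y z Y Z x t D' → FODNLS.TendsToAtInfinity γ D' 1 →
        ∀ ζ, ζ ∉ FODNLS.Contour γ ∪ FODNLS.Poles γ y z Y Z → D ζ = D' ζ) := by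
  refine ⟨fun D => ⟨fun h ζ hζ => h.1.eq_zero hγ hzeros h.2 hζ, fun h =>
    ⟨FODNLS.isRHSolution_of_eq_zero hzeros h, FODNLS.tendsToAtInfinity_of_eq_zero hzeros h⟩⟩, ?_⟩
  intro D D' h hD h' hD' ζ hζ
  -- Jump and residue conditions are linear in `D`, so the difference solves the problem with zero
  -- normalization.
  have hinf : FODNLS.TendsToAtInfinity γ (D - D') 0 := by
    have := Tendsto.sub hD hD'
    rwa [sub_self] at this
  exact sub_eq_zero.1 ((h.sub h').eq_zero hγ hzeros hinf hζ)
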